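/- A \emph{ranking} of a finite simple graph $G$ is a labeling $f:V(G)\to\{1,2,\ldots\}$ such that whenever $u\ne v$ and $f(u)=f(v)$, every $u,v$-path contains a vertex $w$ with $f(w)>f(u)$. In the \emph{on-line ranking game} on a graph $G$, in round $i$ Presenter extends the graph $G_{i-1}$ presented so far ($G_0$ is empty) by one new vertex $v_i$ to a graph $G_i$ isomorphic to an induced subgraph of $G$ (without specifying how $G_i$ is placed in $G$), and Ranker, who sees only $G_i$ and the earlier rounds, irrevocably assigns $v_i$ a positive integer label so that the labels form a ranking of $G_i$. The \emph{on-line ranking number} $\mathring{\rho}(G)$ is the minimum, over all strategies of Ranker, of the largest label that Presenter can force the strategy to use. For $k\ge 2$ and $d\ge 0$, let $T_{k,d}$ be the largest tree of maximum degree at most $k$ and diameter at most $d$, i.e. the tree all of whose internal vertices have degree $k$ and all of whose other vertices have eccentricity $d$. Equivalently, $T_{k,d}$ consists of two rooted trees in which every non-leaf has $k-1$ children and all leaves are at depth $\lfloor d/2\rfloor$ and $\lceil d/2\rceil-1$, respectively (the second tree being empty if $d=0$), together with an edge joining the two roots. \textbf{Theorem.} There exist positive constants $c$ and $c'$ such that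 for all integers $d\ge 0$ and $k\ge 3$, $$c\,(k-1)^{\lfloor d/4\rfloor}\;\le\;\mathring{\rho}(T_{k,d})\;\le\;c'\,(k-1)^{\lfloor d/3\rfloor}.$$ Explicitly, for all integers $d\ge 0$ and $k\ge 3$, $$(k-1)^{\lfloor d/4\rfloor}\;\le\;\mathring{\rho}(T_{k,d})\;\le\;6\,(k-1)^{\lfloor d/3\rfloor}.$$ -/

import Mathlib

namespace OnlineRanking

/-- A ranking of a simple graph: positive integer labels such that every path joining two distinct
vertices with the same label contains a vertex with a larger label. -/
def IsRanking {V : Type*} (G : SimpleGraph V) (f : V → ℕ) : Prop :=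
  (∀ v, 1 ≤ f v) ∧
    ∀ u v : V, u ≠ v → f u = f v →
      ∀ p : G.Walk u v, p.IsPath → ∃ w ∈ p.support, f u < f w

/-- A class of (isomorphism types of) finite graphs, each graph being represented on some `Fin m`. -/
abbrev GraphClass : Type := (m : ℕ) → Set (SimpleGraph (Fin m))

/-- The class of all finite induced subgraphs of `G`. -/
def inducedSubgraphs {V : Type*} (G : SimpleGraph V) : GraphClass :=
  fun _ => {H | Nonempty (H ↪g G)}

/-- The positions that Presenter may produce: `H` is the graph presented so far, its vertex set
`Fin n` being listed in the order of presentation, and it has to be (isomorphic to) an induced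
subgraph of a member of the class. The embedding is existentially quantified: Presenter never
commits to one. -/
def Presentable (𝒢 : GraphClass) {n : ℕ} (H : SimpleGraph (Fin n)) : Prop :=
  ∃ m, ∃ G ∈ 𝒢 m, Nonempty (H ↪g G)

/-- A (deterministic) algorithm for Ranker: when vertex number `n` arrives, it chooses the label of
that vertex from the graph on the vertices `0, …, n` presented so far. The earlier labels are
determined by the algorithm and the earlier graphs, so that it may use them as well; nothing about
vertices that come later is available to it. -/
abbrev Algorithm : Type := (n : ℕ) → SimpleGraph (Fin (n + 1)) → ℕ

/-- The labels that the algorithm has assigned once the graph `H` has been presented: vertex `i` was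
labeled when the graph presented was the one induced by the vertices `0, …, i`. -/
def Algorithm.labels (A : Algorithm) {n : ℕ} (H : SimpleGraph (Fin n)) : Fin n → ℕ :=
  fun i => A i (H.comap (Fin.castLE (Nat.succ_le_of_lt i.isLt)))

/-- The algorithm always obeys the rules: after each round the labels form a ranking. -/
def Algorithm.IsValid (A : Algorithm) (𝒢 : GraphClass) : Prop :=
  ∀ (n : ℕ) (H : SimpleGraph (Fin n)), Presentable 𝒢 H → IsRanking H (A.labels H)

/-- The on-line ranking number of a class of graphs: the least `t` such that Ranker has an algorithm
that obeys the rules and cannot be forced to use a label larger than `t` (`⊤` if there is no finite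
such `t`). -/
noncomputable def onlineRankingNumberOfClass (𝒢 : GraphClass) : ℕ∞ :=
  sInf {t : ℕ∞ | ∃ A : Algorithm, A.IsValid 𝒢 ∧
    ∀ (n : ℕ) (H : SimpleGraph (Fin n)), Presentable 𝒢 H → ∀ i, (A.labels H i : ℕ∞) ≤ t}

/-- The on-line ranking number of a graph. -/
noncomputable def onlineRankingNumber {V : Type*} (G : SimpleGraph V) : ℕ∞ :=
  onlineRankingNumberOfClass (inducedSubgraphs G)

/-- The numbers of levels of the two rooted trees that are joined to form `T_{k,d}`;
together they have `d + 1` levels. -/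
def levels (d : ℕ) : Bool → ℕ
  | true => d / 2 + 1
  | false => (d + 1) / 2

/-- The vertices of `T_{k,d}`. A vertex `(b, w)` lies in the tree number `b`, and the word `w` lists
the choices (the last one first) made on the way down from the root `(b, [])`, there being `k - 1`
children to choose from at each step. -/
abbrev CompleteTreeVertex (k d : ℕ) : Type :=
  {x : Bool × List (Fin (k - 1)) // x.2.length < levels d x.1}

/-- `y` is a child of `x` in one of the two rooted trees. -/
def IsChild {k : ℕ} (x y : Bool × List (Fin (k - 1))) : Prop :=
  y.1 = x.1 ∧ ∃ a, y.2 = a :: x.2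

/-- The tree `T_{k,d}` (for `2 ≤ k`): the tree all of whose internal vertices have degree `k` and
all of whose other vertices have eccentricity `d`. It consists of two rooted trees in which each
vertex above the last level has `k - 1` children, of depths `⌊d/2⌋` and `⌈d/2⌉ - 1` (the second
one being empty if `d = 0`), and of an edge joining their roots. -/
def completeTree (k d : ℕ) : SimpleGraph (CompleteTreeVertex k d) where
  Adj x y := IsChild x.1 y.1 ∨ IsChild y.1 x.1 ∨
    (x.1.1 ≠ y.1.1 ∧ x.1.2 = [] ∧ y.1.2 = [])
  symm := ⟨by
    rintro x y (h | h | ⟨h, hx, hy⟩)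
    · exact Or.inr (Or.inl h)
    · exact Or.inl h
    · exact Or.inr (Or.inr ⟨h.symm, hy, hx⟩)⟩
  loopless := ⟨by
    rintro x (⟨_, a, h⟩ | ⟨_, a, h⟩ | ⟨h, _⟩)
    · exact absurd (congrArg List.length h) (by simp)
    · exact absurd (congrArg List.length h) (by simp)
    · exact h rfl⟩

end OnlineRanking

namespace OnlineRanking
open SimpleGraph Relation
open scoped Classical

/-! Write `q = k - 1`.

Upper bound. Fix `m = d / 6` and a threshold `s`, the number of words of length less than `m` over
`q` letters. A vertex arriving in a component of order at most `s` is small and is labeled by that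
order; a vertex merging two components of order more than `s` is a hub and gets a fresh label above
`M`; any other vertex is an extender and gets `M` minus its level, the length of a longest chain of
extenders each seeing the next through small vertices. The three label ranges are disjoint. If two
extenders are joined by a path without hubs, the vertex of it presented last must be an end (inside,
it would be a hub), and the first extender seen from that end has a smaller level, hence a larger
label.

Few labels suffice. In any placement, one of the two large components at a hub hangs below a child
of it, so hubs lie more than `m` levels above the bottom and number about `q ^ (d / 2 - m)`. An
extender sees at most `(k - 2) * s + 1 = q ^ m` extenders (`card_seen_le`), and a high level forces
a long path (`exists_path_of_level`); paths have length at most `d`, so levels are at most about `q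
^ m * d / 2`. Ranker never needs to know the placement.

Lower bound. With `e = d / 4`, Presenter shows `q ^ e + 1` disjoint `q`-ary trees with `e` levels,
and only then decides that the copy with the smallest maximum label is the top of the tree. One
connecting vertex is added for each of the `q ^ e` positions below it, hanging another copy there.
Each branch now has a maximum at least that of the top copy, and any two branches together with the
top form a connected set, where the largest label is unique. Hence the `q ^ e` branch maxima are
distinct. -/

theorem append_isPath {V : Type*} {G : SimpleGraph V} {u v w : V} {p : G.Walk u v} {q : G.Walk v w}
    (hp : p.IsPath) (hq : q.IsPath) (h : ∀ z ∈ p.support, z ∈ q.support → z = v) :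
    (p.append q).IsPath := by
  rw [Walk.isPath_def, Walk.support_append, List.nodup_append]
  have hq' := hq.support_nodup
  rw [← Walk.cons_tail_support, List.nodup_cons] at hq'
  refine ⟨hp.support_nodup, hq'.2, ?_⟩
  rintro a ha b hb rfl
  exact hq'.1 (h a ha (List.mem_of_mem_tail hb) ▸ hb)

/-- Of the at most `k * K.card` edge ends at the connected set `K`, at least `2 * (K.card - 1)` are
used by edges inside `K`. -/
theorem card_boundary_le {V : Type*} {G : SimpleGraph V} {k : ℕ}
    (hdeg : ∀ v, ∀ S : Finset V, (∀ u ∈ S, G.Adj v u) → S.card ≤ k)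
    (K B : Finset V) (hK : (G.induce (K : Set V)).Connected) (hB : ∀ b ∈ B, b ∉ K)
    (hKB : ∀ b ∈ B, ∃ a ∈ K, G.Adj a b) : B.card + 2 * K.card ≤ k * K.card + 2 := by
  have h1 := hK.card_vert_le_card_edgeSet_add_one
  have h2 := (G.induce (K : Set V)).sum_degrees_eq_twice_card_edges
  have h3 : B.card ≤ ∑ a ∈ K, (B.filter fun b => G.Adj a b).card := by
    rw [← Finset.card_sigma]
    refine Finset.card_le_card_of_surjOn (fun x => x.2) ?_
    intro b hb
    obtain ⟨a, ha, hab⟩ := hKB b hb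
    exact ⟨⟨a, b⟩, by simpa [hab] using ⟨ha, hb⟩, rfl⟩
  have h4 : ∀ a : (K : Set V), (B.filter fun b => G.Adj a b).card +
      (G.induce (K : Set V)).degree a ≤ k := by
    intro a
    rw [← SimpleGraph.card_neighborFinset_eq_degree,
      ← Finset.card_map (f := Function.Embedding.subtype _), ← Finset.card_union_of_disjoint]
    · apply hdeg a
      intro u hu
      simp only [Finset.mem_union, Finset.mem_filter, Finset.mem_map, mem_neighborFinset] at hu
      rcases hu with hu | ⟨x, hx, rfl⟩
      · exact hu.2
      · exact hx
    · rw [Finset.disjoint_left]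
      intro u hu hu'
      simp only [Finset.mem_filter, Finset.mem_map] at hu hu'
      obtain ⟨x, _, rfl⟩ := hu'
      exact hB _ hu.1 x.2
  have h5 : ∑ a ∈ K, (B.filter fun b => G.Adj a b).card =
      ∑ a : (K : Set V), (B.filter fun b => G.Adj a b).card := by
    rw [← Finset.sum_coe_sort K]; rfl
  have h6 : ∑ a : (K : Set V), ((B.filter fun b => G.Adj a b).card +
      (G.induce (K : Set V)).degree a) ≤ ∑ a : (K : Set V), k :=
    Finset.sum_le_sum fun a _ => h4 a
  rw [Finset.sum_add_distrib] at h6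
  simp only [Finset.sum_const, Finset.card_univ, smul_eq_mul] at h6
  have h7 : Fintype.card (K : Set V) = K.card := by simp
  have h8 : Nat.card (K : Set V) = K.card := by simp
  have h9 : Nat.card (G.induce (K : Set V)).edgeSet =
      (G.induce (K : Set V)).edgeFinset.card := by
    rw [Nat.card_eq_fintype_card, ← SimpleGraph.edgeFinset_card]
  rw [h7] at h6
  rw [h8, h9] at h1
  nlinarith

/-! ### Ranker's strategy: small vertices, extenders and hubs -/

/-- The graph presented before round `n`. -/
def before (G : SimpleGraph ℕ) (n : ℕ) : SimpleGraph ℕ where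
  Adj a b := G.Adj a b ∧ a < n ∧ b < n
  symm := ⟨fun _ _ h => ⟨h.1.symm, h.2.2, h.2.1⟩⟩
  loopless := ⟨fun _ h => G.irrefl h.1⟩

/-- The component of `v` in the graph presented before round `n`. -/
def cluster (G : SimpleGraph ℕ) (n v : ℕ) : Set ℕ := {u | (before G n).Reachable v u}

/-- `v` was presented in a component of order at most `s`. -/
def IsSmall (s : ℕ) (G : SimpleGraph ℕ) (v : ℕ) : Prop := (cluster G (v + 1) v).ncard ≤ s

/-- `v` joined two components of order more than `s` when it was presented. -/
def IsHub (s : ℕ) (G : SimpleGraph ℕ) (v : ℕ) : Prop :=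
  ¬ IsSmall s G v ∧ ∃ a b, a ≠ b ∧ (before G (v + 1)).Adj v a ∧ (before G (v + 1)).Adj v b ∧
    s < (cluster G v a).ncard ∧ s < (cluster G v b).ncard

/-- `v` extended a component without being small or a hub. -/
def IsExtender (s : ℕ) (G : SimpleGraph ℕ) (v : ℕ) : Prop := ¬ IsSmall s G v ∧ ¬ IsHub s G v

/-- A step, before round `n`, that leaves a small vertex. -/
def SmallStep (s : ℕ) (G : SimpleGraph ℕ) (n a b : ℕ) : Prop :=
  IsSmall s G a ∧ (before G n).Adj a b

/-- When `v` is presented, the extender `w` is visible from `v` through small vertices. -/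
def Sees (s : ℕ) (G : SimpleGraph ℕ) (v w : ℕ) : Prop :=
  IsExtender s G w ∧ ∃ y, (before G (v + 1)).Adj v y ∧ ReflTransGen (SmallStep s G v) y w

/-- The length of a longest chain of extenders, each of which sees the next, starting at `v`. -/
noncomputable def level (s : ℕ) (G : SimpleGraph ℕ) (v : ℕ) : ℕ :=
  (Finset.univ : Finset (Fin v)).sup fun w => if Sees s G v w then level s G w + 1 else 0
termination_by v
decreasing_by exact w.2

/-- The label of `v`, where `M` is the largest label available to extenders. -/
noncomputable def strategyLabel (s M : ℕ) (G : SimpleGraph ℕ) (v : ℕ) : ℕ :=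
  if IsSmall s G v then (cluster G (v + 1) v).ncard
  else if IsHub s G v then M + ((Finset.range (v + 1)).filter (IsHub s G)).card
  else M - level s G v

/-! ### Labels depend only on the graph presented so far -/

section Congruence

variable {G G' : SimpleGraph ℕ} {s : ℕ}

theorem before_congr {m n : ℕ} (h : before G n = before G' n) (hmn : m ≤ n) :
    before G m = before G' m := by
  ext a b
  have := congrFun (congrFun (congrArg SimpleGraph.Adj h) a) b
  simp only [before, eq_iff_iff] at this ⊢
  constructor
  · rintro ⟨h1, h2, h3⟩; exact ⟨(this.1 ⟨h1, by omega, by omega⟩).1, h2, h3⟩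
  · rintro ⟨h1, h2, h3⟩; exact ⟨(this.2 ⟨h1, by omega, by omega⟩).1, h2, h3⟩

theorem isSmall_congr {v : ℕ} (h : before G (v + 1) = before G' (v + 1)) :
    IsSmall s G v ↔ IsSmall s G' v := by
  simp only [IsSmall, cluster, h]

theorem isHub_congr {v : ℕ} (h : before G (v + 1) = before G' (v + 1)) :
    IsHub s G v ↔ IsHub s G' v := by
  simp only [IsHub, cluster, h, isSmall_congr h, before_congr h (Nat.le_succ v)]

theorem sees_congr {v w : ℕ} (hw : w < v) (h : before G (v + 1) = before G' (v + 1)) :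
    Sees s G v w ↔ Sees s G' v w := by
  have h1 : before G (w + 1) = before G' (w + 1) := before_congr h (by omega)
  have h2 : SmallStep s G v = SmallStep s G' v := by
    ext a b
    simp only [SmallStep, before_congr h (Nat.le_succ v)]
    refine and_congr_left fun hab => isSmall_congr (before_congr h ?_)
    have := hab.2.1
    omega
  simp only [Sees, IsExtender, isSmall_congr h1, isHub_congr h1, h, h2]

theorem level_congr {v : ℕ} (h : before G (v + 1) = before G' (v + 1)) :
    level s G v = level s G' v := by
  induction v using Nat.strong_induction_on with
  | _ v ih =>
    rw [level, level]
    refine Finset.sup_congr rfl fun w _ => ?_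
    rw [ih w w.2 (before_congr h (by omega)), if_congr (sees_congr w.2 h) rfl rfl]

/-- This is what makes the strategy on-line: labels may be analysed in the final graph although each
was computed at its own round. -/
theorem strategyLabel_congr {M v : ℕ} (h : before G (v + 1) = before G' (v + 1)) :
    strategyLabel s M G v = strategyLabel s M G' v := by
  have : (Finset.range (v + 1)).filter (IsHub s G) =
      (Finset.range (v + 1)).filter (IsHub s G') := by
    refine Finset.filter_congr fun w hw => isHub_congr (before_congr h ?_)
    have := Finset.mem_range.1 hw
    omega
  simp only [strategyLabel, isSmall_congr h, isHub_congr h, level_congr h, this, cluster, h]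

end Congruence

/-! ### Components over time and visibility of extenders -/

section Clusters

variable {G : SimpleGraph ℕ} {s : ℕ}

theorem before_mono {m n : ℕ} (h : m ≤ n) : before G m ≤ before G n :=
  fun _ _ hab => ⟨hab.1, by have := hab.2; omega, by have := hab.2; omega⟩

theorem reachable_lt {n a b : ℕ} (h : (before G n).Reachable a b) (ha : a < n) : b < n := by
  obtain ⟨p⟩ := h
  induction p with
  | nil => exact ha
  | cons hab _ ih => exact ih hab.2.2

theorem cluster_finite {n a : ℕ} : (cluster G n a).Finite := by
  refine ((Set.finite_Iio n).insert a).subset fun b hb => ?_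
  by_cases ha : a < n
  · exact Or.inr (reachable_lt hb ha)
  · obtain ⟨p⟩ := hb
    cases p with
    | nil => exact Or.inl rfl
    | cons hab _ => exact absurd hab.2.1 ha

theorem cluster_subset {m n v w : ℕ} (hmn : m ≤ n) (h : (before G n).Reachable v w) :
    cluster G m w ⊆ cluster G n v :=
  fun _ hx => h.trans (hx.mono (before_mono hmn))

theorem lt_ncard_cluster {n v w : ℕ} (hw : ¬ IsSmall s G w) (hwn : w < n)
    (h : (before G n).Reachable v w) : s < (cluster G n v).ncard :=
  (not_le.1 hw).trans_le (Set.ncard_le_ncard (cluster_subset hwn h) cluster_finite)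

theorem not_isSmall_of_reachable {v w : ℕ} (hw : ¬ IsSmall s G w)
    (h : (before G (v + 1)).Reachable v w) : ¬ IsSmall s G v :=
  not_le.2 (lt_ncard_cluster hw (reachable_lt h (Nat.lt_succ_self v)) h)

theorem ncard_cluster_lt {v w : ℕ} (h : (before G (v + 1)).Reachable v w) (hne : w ≠ v) :
    (cluster G (w + 1) w).ncard < (cluster G (v + 1) v).ncard := by
  have hw : w < v + 1 := reachable_lt h (Nat.lt_succ_self v)
  refine Set.ncard_lt_ncard ⟨cluster_subset (by omega) h, fun hs => ?_⟩ cluster_finite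
  have : v < w + 1 := reachable_lt (hs (Reachable.refl v)) (Nat.lt_succ_self w)
  omega

theorem reachable_of_walk {n a b : ℕ} (p : G.Walk a b) (h : ∀ x ∈ p.support, x < n) :
    (before G n).Reachable a b := by
  induction p with
  | nil => exact Reachable.refl _
  | cons hab p ih =>
    simp only [Walk.support_cons, List.mem_cons, forall_eq_or_imp] at h
    exact (Adj.reachable (G := before G n) ⟨hab, h.1, h.2 _ p.start_mem_support⟩).trans (ih h.2)

theorem adj_before_succ {v y : ℕ} (h : (before G (v + 1)).Adj v y) : G.Adj v y ∧ y < v :=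
  ⟨h.1, lt_of_le_of_ne (Nat.le_of_lt_succ h.2.2) h.1.ne'⟩

theorem SmallStep.mono {m n a b : ℕ} (hmn : m ≤ n) (h : SmallStep s G m a b) :
    SmallStep s G n a b := ⟨h.1, before_mono hmn h.2⟩

theorem reachable_of_steps {n a b : ℕ} (h : ReflTransGen (SmallStep s G n) a b) :
    (before G n).Reachable a b := by
  induction h with
  | refl => exact Reachable.refl _
  | tail _ h ih => exact ih.trans h.2.reachable

/-- Small vertices that lead to a vertex `w` which is not small were presented before `w`. -/
theorem reachable_before_of_steps {n y b w : ℕ} (h : ReflTransGen (SmallStep s G n) y b)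
    (hb : IsSmall s G b) (hw : ¬ IsSmall s G w) (hbw : G.Adj b w) :
    y < w ∧ (before G w).Reachable y b := by
  -- A vertex arriving after `w` in a component that contains `w` cannot be small, since the
  -- component of `w` was already too large.
  have hlt : ∀ y, IsSmall s G y → ((y > w) → (before G (y + 1)).Reachable y w) → y < w := by
    intro y hy hyw
    rcases lt_trichotomy y w with h | h | h
    · exact h
    · exact absurd hy (h ▸ hw)
    · exact absurd hy (not_isSmall_of_reachable hw (hyw h))
  induction h using ReflTransGen.head_induction_on with
  | refl => exact ⟨hlt _ hb fun h => Adj.reachable ⟨hbw, by omega, by omega⟩, Reachable.refl _⟩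
  | @head y c hyc _ ih =>
    have : y < w := by
      refine hlt _ hyc.1 fun h => ?_
      have h1 : (before G (y + 1)).Adj y c := ⟨hyc.2.1, by omega, by omega⟩
      have hbw' : b < w := reachable_lt ih.2 ih.1
      have h2 : (before G (y + 1)).Adj b w := ⟨hbw, by omega, by omega⟩
      exact (h1.reachable.trans (ih.2.mono (before_mono (by omega)))).trans h2.reachable
    exact ⟨this, (Adj.reachable (G := before G w) ⟨hyc.2.1, this, ih.1⟩).trans ih.2⟩

theorem Sees.lt {v w : ℕ} (h : Sees s G v w) : w < v := by
  obtain ⟨_, y, hy, hyw⟩ := h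
  exact reachable_lt (reachable_of_steps hyw) (adj_before_succ hy).2

theorem level_lt_of_sees {v w : ℕ} (h : Sees s G v w) : level s G w < level s G v := by
  have h1 := Finset.le_sup (f := fun w : Fin v => if Sees s G v w then level s G w + 1 else 0)
    (Finset.mem_univ ⟨w, h.lt⟩)
  rw [← level] at h1
  simp only [h, if_true] at h1
  omega

theorem level_le {v n : ℕ} (h : ∀ w, Sees s G v w → level s G w + 1 ≤ n) : level s G v ≤ n := by
  rw [level]
  refine Finset.sup_le fun w _ => ?_
  split_ifs with hw
  · exact h _ hw
  · exact Nat.zero_le _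

/-- An extender is not a hub, so only one neighbor can lead to a large component when it arrives. -/
theorem eq_of_big_branches {v a b x y : ℕ} (hv : IsExtender s G v)
    (ha : (before G (v + 1)).Adj v a) (hb : (before G (v + 1)).Adj v b)
    (hx : ¬ IsSmall s G x) (hy : ¬ IsSmall s G y) (hax : (before G v).Reachable a x)
    (hby : (before G v).Reachable b y) : a = b := by
  by_contra hab
  exact hv.2 ⟨hv.1, a, b, hab, ha, hb,
    lt_ncard_cluster hx (reachable_lt hax (adj_before_succ ha).2) hax,
    lt_ncard_cluster hy (reachable_lt hby (adj_before_succ hb).2) hby⟩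

theorem eq_or_steps_of_extender {n y w : ℕ} (h : ReflTransGen (SmallStep s G n) y w) :
    y = w ∨ (IsSmall s G y ∧ ∃ b, ReflTransGen (SmallStep s G n) y b ∧ SmallStep s G n b w) := by
  rcases h.cases_head with h1 | ⟨c, hc, _⟩
  · exact Or.inl h1
  · rcases h.cases_tail with h2 | ⟨b, hb, hbw⟩
    · exact Or.inl h2.symm
    · exact Or.inr ⟨hc.1, b, hb, hbw⟩

/-- When `w` arrived, its neighbor `b` on the small route from `v` already led to the older extender
`x`. That is therefore the only large branch at `w`, so whatever `w` sees is seen through `b`, and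
the route from `v` to `b` can be continued to it. -/
theorem sees_of_sees_sees {v w x z : ℕ} (hv : IsExtender s G v) (hx : Sees s G v x)
    (hw : Sees s G v w) (hxw : x < w) (hz : Sees s G w z) : Sees s G v z := by
  obtain ⟨hxE, y, hy, hyx⟩ := hx
  have hwlt := hw.lt
  obtain ⟨hwE, y', hy', hyw⟩ := hw
  obtain rfl := eq_of_big_branches hv hy hy' hxE.1 hwE.1 (reachable_of_steps hyx)
    (reachable_of_steps hyw)
  rcases eq_or_steps_of_extender hyw with rfl | ⟨hys, b, hyb, hbw⟩
  · rcases eq_or_steps_of_extender hyx with rfl | ⟨hys, _⟩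
    · exact absurd hxw (lt_irrefl _)
    · exact absurd hys hwE.1
  obtain ⟨hyw', hyb'⟩ := reachable_before_of_steps hyb hbw.1 hwE.1 hbw.2.1
  have hyx' : (before G w).Reachable y x := by
    rcases eq_or_steps_of_extender hyx with rfl | ⟨_, c, hyc, hcx⟩
    · exact Reachable.refl _
    · obtain ⟨hyx', hyc'⟩ := reachable_before_of_steps hyc hcx.1 hxE.1 hcx.2.1
      have hcx' : c < x := reachable_lt hyc' hyx'
      exact (hyc'.mono (before_mono hxw.le)).trans (Adj.reachable ⟨hcx.2.1, by omega, hxw⟩)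
  have hbw' : b < w := reachable_lt hyb' hyw'
  obtain ⟨hzE, c, hc, hcz⟩ := hz
  obtain rfl := eq_of_big_branches hwE (a := b) ⟨hbw.2.1.symm, by omega, by omega⟩ hc hxE.1 hzE.1
    (hyb'.symm.trans hyx') (reachable_of_steps hcz)
  exact ⟨hzE, y, hy, hyb.trans (ReflTransGen.mono (fun _ _ h => SmallStep.mono hwlt.le h) _ _ hcz)⟩

theorem exists_walk_of_steps {n y w : ℕ} (h : ReflTransGen (SmallStep s G n) y w) :
    ∃ p : G.Walk y w, ∀ z ∈ p.support, z ≠ w →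
      IsSmall s G z ∧ ReflTransGen (SmallStep s G n) y z := by
  induction h using ReflTransGen.head_induction_on with
  | refl => exact ⟨Walk.nil, by simp⟩
  | head hyc _ ih =>
    obtain ⟨p, hp⟩ := ih
    refine ⟨Walk.cons hyc.2.1 p, fun z hz hzw => ?_⟩
    rw [Walk.support_cons, List.mem_cons] at hz
    rcases hz with rfl | hz
    · exact ⟨hyc.1, ReflTransGen.refl⟩
    · exact ⟨(hp z hz hzw).1, (hp z hz hzw).2.head hyc⟩

/-- A walk without hubs that ends at an extender meets an extender after small vertices only. -/
theorem exists_extender_of_walk {n y u : ℕ} (p : G.Walk y u) (hn : ∀ x ∈ p.support, x < n)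
    (hhub : ∀ x ∈ p.support, ¬ IsHub s G x) (hu : IsExtender s G u) :
    ∃ w ∈ p.support, IsExtender s G w ∧ ReflTransGen (SmallStep s G n) y w := by
  induction p with
  | nil => exact ⟨_, by simp, hu, ReflTransGen.refl⟩
  | @cons a b c hab p ih =>
    by_cases ha : IsSmall s G a
    · simp only [Walk.support_cons, List.mem_cons, forall_eq_or_imp] at hn hhub
      obtain ⟨w, hw, hwE, hbw⟩ := ih hn.2 hhub.2 hu
      exact ⟨w, by simp [hw], hwE, hbw.head ⟨ha, hab, hn.1, hn.2 _ p.start_mem_support⟩⟩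
    · exact ⟨a, by simp, ⟨ha, hhub a (by simp)⟩, ReflTransGen.refl⟩

end Clusters

/-! ### Bounding the level of an extender -/

section Bounds

variable {G : SimpleGraph ℕ} {s k : ℕ}

/-- The extenders that `v` sees. -/
noncomputable def seen (s : ℕ) (G : SimpleGraph ℕ) (v : ℕ) : Finset ℕ :=
  (Finset.range v).filter (Sees s G v)

theorem mem_seen {v w : ℕ} : w ∈ seen s G v ↔ Sees s G v w := by
  simp only [seen, Finset.mem_filter, Finset.mem_range, and_iff_right_iff_imp]
  exact Sees.lt

/-- A chain leaving `v` stays among the extenders seen by `v` until it reaches the oldest one, `x`,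
by `sees_of_sees_sees`. Its members get strictly older, so it spends at most `(seen s G v).card`
steps before the level of `x` takes over. -/
theorem level_le_add_card {v x : ℕ} (hv : IsExtender s G v) (hx : Sees s G v x)
    (hmin : ∀ w, Sees s G v w → x ≤ w) : level s G v ≤ level s G x + (seen s G v).card := by
  have key : ∀ w, Sees s G v w →
      level s G w ≤ level s G x + ((seen s G v).filter (· < w)).card := by
    intro w
    induction w using Nat.strong_induction_on with
    | _ w ih =>
      intro hw
      rcases (hmin w hw).eq_or_lt with rfl | hxw
      · exact Nat.le_add_right _ _
      refine level_le fun z hz => ?_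
      have hvz := sees_of_sees_sees hv hx hw hxw hz
      have h1 := ih z hz.lt hvz
      have h2 : ((seen s G v).filter (· < z)).card < ((seen s G v).filter (· < w)).card := by
        refine Finset.card_lt_card ⟨fun u hu => ?_, fun h => ?_⟩
        · simp only [Finset.mem_filter] at hu ⊢
          exact ⟨hu.1, hu.2.trans hz.lt⟩
        · have := h (Finset.mem_filter.2 ⟨mem_seen.2 hvz, hz.lt⟩)
          exact lt_irrefl _ (Finset.mem_filter.1 this).2
      omega
  refine level_le fun w hw => ?_
  have h1 := key w hw
  have h2 : ((seen s G v).filter (· < w)).card < (seen s G v).card := by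
    refine Finset.card_lt_card ⟨Finset.filter_subset _ _, fun h => ?_⟩
    have := h (mem_seen.2 hw)
    exact lt_irrefl _ (Finset.mem_filter.1 this).2
  omega

/-- Everything seen lies behind one neighbor `y` of `v`. If `y` is small, the small vertices reached
from it form a connected set `K` of order at most `s`, because its last vertex was small on arrival.
Both `v` and the seen extenders lie on the boundary of `K`, so `card_boundary_le` applies. -/
theorem card_seen_le (hk : 2 ≤ k)
    (hdeg : ∀ v, ∀ S : Finset ℕ, (∀ u ∈ S, G.Adj v u) → S.card ≤ k)
    {v : ℕ} (hv : IsExtender s G v) : (seen s G v).card ≤ (k - 2) * s + 1 := by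
  rcases (seen s G v).eq_empty_or_nonempty with h0 | ⟨x, hx⟩
  · simp [h0]
  obtain ⟨hxE, y, hy, hyx⟩ := mem_seen.1 hx
  have huniq : ∀ w, Sees s G v w → ReflTransGen (SmallStep s G v) y w := by
    rintro w ⟨hwE, y', hy', hyw⟩
    obtain rfl := eq_of_big_branches hv hy hy' hxE.1 hwE.1 (reachable_of_steps hyx)
      (reachable_of_steps hyw)
    exact hyw
  by_cases hys : IsSmall s G y
  swap
  · have : (seen s G v).card ≤ 1 := by
      refine Finset.card_le_one.2 fun a ha b hb => ?_
      rcases eq_or_steps_of_extender (huniq a (mem_seen.1 ha)) with h1 | h1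
      · rcases eq_or_steps_of_extender (huniq b (mem_seen.1 hb)) with h2 | h2
        · exact h1.symm.trans h2
        · exact absurd h2.1 hys
      · exact absurd h1.1 hys
    omega
  have hyv := (adj_before_succ hy).2
  set K : Finset ℕ := (Finset.range v).filter fun b =>
    IsSmall s G b ∧ ReflTransGen (SmallStep s G v) y b with hKdef
  have hyK : y ∈ K := by simp [hKdef, hyv, hys, ReflTransGen.refl]
  have hmemK : ∀ b, ReflTransGen (SmallStep s G v) y b → IsSmall s G b → b ∈ K := fun b hb hbs => by
    simp only [hKdef, Finset.mem_filter, Finset.mem_range]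
    exact ⟨reachable_lt (reachable_of_steps hb) hyv, hbs, hb⟩
  have hreach : ∀ b, ReflTransGen (SmallStep s G v) y b → ∀ hb : b ∈ K,
      (G.induce (K : Set ℕ)).Reachable ⟨y, hyK⟩ ⟨b, hb⟩ := by
    intro b hyb
    induction hyb with
    | refl => exact fun _ => Reachable.refl _
    | @tail c b hyc hcb ih =>
      intro hb
      have hc := hmemK c hyc hcb.1
      refine (ih hc).trans (Adj.reachable ?_)
      exact hcb.2.1
  have hconn : (G.induce (K : Set ℕ)).Connected := by
    have : ∀ b : (K : Set ℕ), (G.induce (K : Set ℕ)).Reachable ⟨y, hyK⟩ b := fun b =>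
      hreach b (Finset.mem_filter.1 b.2).2.2 b.2
    exact { preconnected := fun a b => (this a).symm.trans (this b), nonempty := ⟨⟨y, hyK⟩⟩ }
  have hKs : K.card ≤ s := by
    obtain ⟨a, haK, hmax⟩ := K.exists_max_image id ⟨y, hyK⟩
    have ha : IsSmall s G a := (Finset.mem_filter.1 haK).2.1
    refine le_trans ?_ ha
    rw [← Set.ncard_coe_finset]
    refine Set.ncard_le_ncard (fun b hb => ?_) cluster_finite
    let f : G.induce (K : Set ℕ) →g before G (a + 1) :=
      ⟨Subtype.val, fun {b c} hbc => ⟨hbc, Nat.lt_succ_of_le (hmax b b.2),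
        Nat.lt_succ_of_le (hmax c c.2)⟩⟩
    exact (hconn.preconnected ⟨a, haK⟩ ⟨b, hb⟩).map f
  have hB := card_boundary_le hdeg K (insert v (seen s G v)) hconn
    (by
      intro b hb hbK
      have hbs := (Finset.mem_filter.1 hbK).2.1
      rcases Finset.mem_insert.1 hb with rfl | hb
      · exact hv.1 hbs
      · exact (mem_seen.1 hb).1.1 hbs)
    (by
      intro b hb
      rcases Finset.mem_insert.1 hb with rfl | hb
      · exact ⟨y, hyK, hy.1.symm⟩
      · have hb' := mem_seen.1 hb
        rcases eq_or_steps_of_extender (huniq b hb') with rfl | ⟨_, c, hyc, hcb⟩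
        · exact absurd hys hb'.1.1
        · exact ⟨c, hmemK c hyc hcb.1, hcb.2.1⟩)
  rw [Finset.card_insert_of_notMem (fun h => lt_irrefl _ (mem_seen.1 h).lt)] at hB
  obtain ⟨j, rfl⟩ := Nat.exists_eq_add_of_le hk
  have h1 : j * K.card ≤ j * s := Nat.mul_le_mul_left _ hKs
  have h2 : (2 + j) * K.card = 2 * K.card + j * K.card := by ring
  simp only [Nat.add_sub_cancel_left]
  omega

/-- Descend repeatedly to the oldest extender seen. A step along a single edge raises the level by
at most 1, which costs `2 ≤ N`; a longer step raises it by at most `N` but adds at least 2 to the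
length. Both keep the ratio `N / 2` of level to length. -/
theorem exists_path_of_level (hk : 2 ≤ k) {N : ℕ} (hN2 : 2 ≤ N) (hN : (k - 2) * s + 1 ≤ N)
    (hdeg : ∀ v, ∀ S : Finset ℕ, (∀ u ∈ S, G.Adj v u) → S.card ≤ k)
    {v : ℕ} (hv : IsExtender s G v) :
    ∃ r, ∃ p : G.Walk v r, p.IsPath ∧ IsExtender s G r ∧
      (∀ x ∈ p.support, x ≤ v ∧ ¬ IsHub s G x) ∧ 2 * level s G v ≤ N * p.length := by
  induction v using Nat.strong_induction_on with
  | _ v ih =>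
    by_cases h0 : ∀ w, ¬ Sees s G v w
    · refine ⟨v, Walk.nil, Walk.IsPath.nil, hv, by simpa using hv.2, ?_⟩
      have : level s G v ≤ 0 := level_le fun w hw => absurd hw (h0 w)
      omega
    push Not at h0
    have hx := Nat.find_spec h0
    have hmin : ∀ w, Sees s G v w → Nat.find h0 ≤ w := fun w hw => Nat.find_min' h0 hw
    generalize Nat.find h0 = x at hx hmin
    have hxv := hx.lt
    have hlev := level_le_add_card hv hx hmin
    have hcard := card_seen_le hk hdeg hv
    obtain ⟨r, p, hp, hr, hsupp, hlen⟩ := ih x hxv hx.1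
    have hxs := hx
    obtain ⟨hxE, y, hy, hyx⟩ := hxs
    obtain ⟨w, hw⟩ := exists_walk_of_steps hyx
    have hvy := adj_before_succ hy
    set q := (Walk.cons hvy.1 w).bypass with hq
    have hqs : ∀ z ∈ q.support, z = v ∨ z = x ∨
        IsSmall s G z ∧ ReflTransGen (SmallStep s G v) y z := by
      intro z hz
      have := Walk.support_bypass_subset_support _ hz
      rw [Walk.support_cons, List.mem_cons] at this
      rcases this with h | h
      · exact Or.inl h
      · by_cases hzx : z = x
        · exact Or.inr (Or.inl hzx)
        · exact Or.inr (Or.inr (hw z h hzx))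
    have hlt : ∀ z, ReflTransGen (SmallStep s G v) y z → z < v := fun z hz =>
      reachable_lt (reachable_of_steps hz) hvy.2
    refine ⟨r, q.append p, append_isPath (Walk.bypass_isPath _) hp ?_, hr, ?_, ?_⟩
    · intro z hzq hzp
      rcases hqs z hzq with rfl | rfl | ⟨hzs, hyz⟩
      · have := (hsupp z hzp).1
        omega
      · rfl
      -- If the new piece met `p` before `x`, following `p` onward would show `v` an extender older
      -- than `x`, against the choice of `x`.
      · by_contra hzx
        obtain ⟨u, hu, huE, hzu⟩ := exists_extender_of_walk (n := v) (p.dropUntil z hzp)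
          (fun t ht => lt_of_le_of_lt (hsupp t (Walk.support_dropUntil_subset_support _ _ ht)).1 hxv)
          (fun t ht => (hsupp t (Walk.support_dropUntil_subset_support _ _ ht)).2) hr
        have hux : u ≠ x := by
          rintro rfl
          have h1 := hp.support_nodup
          rw [← Walk.take_spec p hzp, Walk.support_append, List.nodup_append] at h1
          rw [← Walk.cons_tail_support, List.mem_cons] at hu
          rcases hu with h | hu
          · exact hzx h.symm
          · exact h1.2.2 _ (Walk.start_mem_support _) _ hu rfl
        have h1 := (hsupp u (Walk.support_dropUntil_subset_support _ _ hu)).1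
        have h2 := hmin u ⟨huE, y, hy, hyz.trans hzu⟩
        omega
    · intro z hz
      rw [Walk.mem_support_append_iff] at hz
      rcases hz with hz | hz
      · rcases hqs z hz with rfl | rfl | ⟨hzs, hyz⟩
        · exact ⟨le_rfl, hv.2⟩
        · exact ⟨hxv.le, hxE.2⟩
        · exact ⟨(hlt z hyz).le, fun h => h.1 hzs⟩
      · exact ⟨(hsupp z hz).1.trans hxv.le, (hsupp z hz).2⟩
    · rw [Walk.length_append, mul_add]
      have hq0 : q.length ≠ 0 := fun h => hxv.ne' (Walk.eq_of_length_eq_zero h)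
      -- If `x` is itself adjacent to `v`, it blocks the only large branch, and nothing else is
      -- seen.
      have hq1 : q.length = 1 → (seen s G v).card ≤ 1 := by
        intro h
        have hadj := Walk.adj_of_length_eq_one h
        have hadj' : (before G (v + 1)).Adj v x := ⟨hadj, by omega, by omega⟩
        refine Finset.card_le_one.2 fun a ha b hb => ?_
        have : ∀ a ∈ seen s G v, x = a := by
          intro a ha
          obtain ⟨haE, c, hc, hca⟩ := mem_seen.1 ha
          obtain rfl := eq_of_big_branches hv hadj' hc hxE.1 haE.1 (Reachable.refl _)
            (reachable_of_steps hca)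
          rcases eq_or_steps_of_extender hca with h | h
          · exact h
          · exact absurd h.1 hxE.1
        exact (this a ha).symm.trans (this b hb)
      by_cases h1 : q.length = 1
      · have := hq1 h1
        rw [h1]
        omega
      · have h2 : N * 2 ≤ N * q.length := Nat.mul_le_mul_left _ (by omega)
        omega

end Bounds

/-! ### The strategy produces a ranking -/

section Ranking

variable {G : SimpleGraph ℕ} {s M D : ℕ}

theorem strategyLabel_small {v : ℕ} (h : IsSmall s G v) :
    strategyLabel s M G v = (cluster G (v + 1) v).ncard := if_pos h

theorem strategyLabel_hub {v : ℕ} (h : IsHub s G v) : strategyLabel s M G v =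
    M + ((Finset.range (v + 1)).filter (IsHub s G)).card := by
  rw [strategyLabel, if_neg h.1, if_pos h]

theorem strategyLabel_extender {v : ℕ} (h : IsExtender s G v) :
    strategyLabel s M G v = M - level s G v := by
  rw [strategyLabel, if_neg h.1, if_neg h.2]

theorem lt_strategyLabel_hub {v : ℕ} (h : IsHub s G v) : M < strategyLabel s M G v := by
  rw [strategyLabel_hub h, lt_add_iff_pos_right, Finset.card_pos]
  exact ⟨v, by simp [h]⟩

theorem strategyLabel_strictMono_hub {u v : ℕ} (hv : IsHub s G v) (huv : u < v) (hu : IsHub s G u) :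
    strategyLabel s M G u < strategyLabel s M G v := by
  rw [strategyLabel_hub hu, strategyLabel_hub hv, add_lt_add_iff_left]
  refine Finset.card_lt_card ⟨fun w hw => ?_, fun h => ?_⟩
  · simp only [Finset.mem_filter, Finset.mem_range] at hw ⊢
    exact ⟨by omega, hw.2⟩
  · have := h (Finset.mem_filter.2 ⟨Finset.mem_range.2 (Nat.lt_succ_self v), hv⟩)
    simp only [Finset.mem_filter, Finset.mem_range] at this
    omega

theorem strategyLabel_pos (hsM : s < M)
    (hlev : ∀ v, IsExtender s G v → level s G v + s + 1 ≤ M)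
    (v : ℕ) :
    1 ≤ strategyLabel s M G v := by
  by_cases h1 : IsSmall s G v
  · rw [strategyLabel_small h1, Nat.succ_le_iff, Set.ncard_pos cluster_finite]
    exact ⟨v, Reachable.refl _⟩
  by_cases h2 : IsHub s G v
  · have := lt_strategyLabel_hub (M := M) h2
    omega
  · have := hlev v ⟨h1, h2⟩
    rw [strategyLabel_extender ⟨h1, h2⟩]
    omega

/-- On a path that ends at its vertex presented last, the label of an extender at both ends is
exceeded. -/
theorem exists_lt_of_extender {u v : ℕ} (hlev : ∀ v, IsExtender s G v → level s G v ≤ M)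
    (hu : IsExtender s G u) (hv : IsExtender s G v) (huv : u ≠ v) (p : G.Walk v u)
    (hp : p.IsPath) (hmax : ∀ x ∈ p.support, x ≤ v) (hhub : ∀ x ∈ p.support, ¬ IsHub s G x) :
    ∃ w ∈ p.support, strategyLabel s M G v < strategyLabel s M G w := by
  cases p with
  | nil => exact absurd rfl huv
  | @cons _ y _ hvy p =>
    rw [Walk.cons_isPath_iff] at hp
    simp only [Walk.support_cons, List.mem_cons, forall_eq_or_imp] at hmax hhub
    have hlt : ∀ x ∈ p.support, x < v := fun x hx =>
      lt_of_le_of_ne (hmax.2 x hx) fun h => hp.2 (h ▸ hx)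
    obtain ⟨w, hw, hwE, hyw⟩ := exists_extender_of_walk p hlt hhub.2 hu
    have hs : Sees s G v w := ⟨hwE, y, ⟨hvy, Nat.lt_succ_self v,
      (hlt y p.start_mem_support).trans (Nat.lt_succ_self v)⟩, hyw⟩
    refine ⟨w, by simp [hw], ?_⟩
    rw [strategyLabel_extender hv, strategyLabel_extender hwE]
    have := level_lt_of_sees hs
    have := hlev v hv
    omega

/-- Equal labels force equal types, as small labels are at most `s`, extender labels lie in `(s, M]`
and hub labels exceed `M`. A path with no larger label is then contradicted at its vertex `z`
presented last. -/
theorem strategyLabel_isRanking (hsM : s < M)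
    (hlev : ∀ v, IsExtender s G v → level s G v + s + 1 ≤ M) :
    IsRanking G (strategyLabel s M G) := by
  refine ⟨strategyLabel_pos hsM hlev, fun u v huv hf p hp => ?_⟩
  by_contra hcon
  push Not at hcon
  have hsm : ∀ x, IsSmall s G x → strategyLabel s M G x ≤ s := fun x hx =>
    (strategyLabel_small hx).le.trans hx
  have hex : ∀ x, IsExtender s G x → s < strategyLabel s M G x ∧ strategyLabel s M G x ≤ M :=
    fun x hx => by
      have := hlev x hx
      rw [strategyLabel_extender hx]
      omega
  have hhb : ∀ x, IsHub s G x → M < strategyLabel s M G x := fun x hx => lt_strategyLabel_hub hx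
  have hcases : ∀ x, IsSmall s G x ∨ IsExtender s G x ∨ IsHub s G x := fun x => by
    by_cases h1 : IsSmall s G x
    · exact Or.inl h1
    · by_cases h2 : IsHub s G x
      · exact Or.inr (Or.inr h2)
      · exact Or.inr (Or.inl ⟨h1, h2⟩)
  obtain ⟨z, hzm, hzmax⟩ := p.support.toFinset.exists_max_image id ⟨u, by simp⟩
  simp only [List.mem_toFinset, id] at hzm hzmax
  have hreach : ∀ x ∈ p.support, (before G (z + 1)).Reachable z x := by
    have : ∀ x ∈ p.support, (before G (z + 1)).Reachable u x := fun x hx =>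
      reachable_of_walk (p.takeUntil x hx) fun t ht =>
        Nat.lt_succ_of_le (hzmax t (Walk.support_takeUntil_subset_support _ _ ht))
    exact fun x hx => (this z hzm).symm.trans (this x hx)
  rcases hcases u with hu | hu | hu
  · have hz : IsSmall s G z := by
      have h1 := hcon z hzm
      have h2 := hsm u hu
      rcases hcases z with h | h | h
      · exact h
      · have := hex z h
        omega
      · have := hhb z h
        omega
    have hv : IsSmall s G v := by
      have h2 := hsm u hu
      rcases hcases v with h | h | h
      · exact h
      · have := hex v h
        omega
      · have := hhb v h
        omega
    -- The component seen on arrival strictly grows along a connected set, so `z` outranks every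
    -- other small vertex of the path.
    have key : ∀ x ∈ p.support, IsSmall s G x → x ≠ z →
        strategyLabel s M G x < strategyLabel s M G z := fun x hx hxs hxz => by
      rw [strategyLabel_small hxs, strategyLabel_small hz]
      exact ncard_cluster_lt (hreach x hx) hxz
    have h1 := hcon z hzm
    by_cases huz : u = z
    · have := key v p.end_mem_support hv (huz ▸ huv.symm)
      omega
    · have := key u p.start_mem_support hu huz
      omega
  · have hnh : ∀ x ∈ p.support, ¬ IsHub s G x := fun x hx hh => by
      have h1 := hcon x hx
      have h2 := hhb x hh
      have h3 := hex u hu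
      omega
    have hv : IsExtender s G v := by
      have h2 := hex u hu
      rcases hcases v with h | h | h
      · have := hsm v h
        omega
      · exact h
      · exact absurd h (hnh v p.end_mem_support)
    have hlev' : ∀ v, IsExtender s G v → level s G v ≤ M := fun v hv => by
      have := hlev v hv
      omega
    by_cases hzu : z = u
    · subst hzu
      obtain ⟨w, hw, h⟩ := exists_lt_of_extender hlev' hv hu huv.symm p hp hzmax hnh
      exact absurd (hcon w hw) (not_le.2 h)
    by_cases hzv : z = v
    · subst hzv
      obtain ⟨w, hw, h⟩ := exists_lt_of_extender hlev' hu hv huv p.reverse hp.reverse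
        (by simpa using hzmax) (by simpa using hnh)
      rw [Walk.support_reverse, List.mem_reverse] at hw
      exact absurd (hcon w hw) (not_le.2 (hf ▸ h))
    -- Strictly inside the path, `z` joined two components that each contain an extender, so it is a
    -- hub.
    apply hnh z hzm
    refine ⟨not_isSmall_of_reachable hu.1 (hreach u p.start_mem_support), ?_⟩
    have hbr : ∀ t (q : G.Walk z t), q.IsPath → (∀ x ∈ q.support, x ≤ z) → IsExtender s G t →
        z ≠ t → ∃ a ∈ q.support.tail, (before G (z + 1)).Adj z a ∧ s < (cluster G z a).ncard := by
      intro t q hq hqm ht hzt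
      cases q with
      | nil => exact absurd rfl hzt
      | @cons _ a _ hza q =>
        rw [Walk.cons_isPath_iff] at hq
        simp only [Walk.support_cons, List.mem_cons, forall_eq_or_imp] at hqm
        have hlt : ∀ x ∈ q.support, x < z := fun x hx =>
          lt_of_le_of_ne (hqm.2 x hx) fun h => hq.2 (h ▸ hx)
        refine ⟨a, by simp, ⟨hza, Nat.lt_succ_self z,
          (hlt a q.start_mem_support).trans (Nat.lt_succ_self z)⟩, ?_⟩
        exact lt_ncard_cluster ht.1 (hlt t q.end_mem_support) (reachable_of_walk q hlt)
    have hsplit := hp.support_nodup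
    rw [← Walk.take_spec p hzm, Walk.support_append, List.nodup_append] at hsplit
    obtain ⟨a, ha, ha'⟩ := hbr u (p.takeUntil z hzm).reverse (hp.takeUntil hzm).reverse
      (fun x hx => hzmax x (Walk.support_takeUntil_subset_support _ _ (by simpa using hx))) hu hzu
    obtain ⟨b, hb, hb'⟩ := hbr v (p.dropUntil z hzm) (hp.dropUntil hzm)
      (fun x hx => hzmax x (Walk.support_dropUntil_subset_support _ _ hx)) hv hzv
    have ha2 := List.mem_of_mem_tail ha
    rw [Walk.support_reverse, List.mem_reverse] at ha2
    exact ⟨a, b, hsplit.2.2 a ha2 b hb, ha'.1, hb'.1, ha'.2, hb'.2⟩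
  · have hv : IsHub s G v := by
      have h2 := hhb u hu
      rcases hcases v with h | h | h
      · have := hsm v h
        omega
      · have := hex v h
        omega
      · exact h
    rcases lt_or_gt_of_ne huv with h | h
    · have := strategyLabel_strictMono_hub (M := M) hv h hu
      omega
    · have := strategyLabel_strictMono_hub (M := M) hu h hv
      omega

theorem strategyLabel_le {Γ : ℕ} (hsM : s < M)
    (hhub : ∀ S : Finset ℕ, (∀ v ∈ S, IsHub s G v) → S.card ≤ Γ) (v : ℕ) :
    strategyLabel s M G v ≤ M + Γ := by
  by_cases h1 : IsSmall s G v
  · rw [strategyLabel_small h1]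
    exact h1.trans (by omega)
  by_cases h2 : IsHub s G v
  · rw [strategyLabel_hub h2]
    exact Nat.add_le_add_left (hhub _ fun w hw => (Finset.mem_filter.1 hw).2) _
  · rw [strategyLabel_extender ⟨h1, h2⟩]
    omega

end Ranking

/-! ### Degrees, paths and branches in the complete tree -/

section Tree

variable {k d : ℕ}

theorem completeTree_degree_le (hk : 1 ≤ k) (x : CompleteTreeVertex k d)
    (S : Finset (CompleteTreeVertex k d)) (hS : ∀ y ∈ S, (completeTree k d).Adj x y) :
    S.card ≤ k := by
  obtain ⟨⟨b, w⟩, hx⟩ := x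
  let g : Option (Fin (k - 1)) → Bool × List (Fin (k - 1)) := fun o =>
    o.elim (if w = [] then (!b, []) else (b, w.tail)) fun a => (b, a :: w)
  have h1 : S.image Subtype.val ⊆ Finset.univ.image g := by
    intro y hy
    obtain ⟨⟨⟨b', w'⟩, hy'⟩, hyS, rfl⟩ := Finset.mem_image.1 hy
    have := hS _ hyS
    simp only [Finset.mem_image, Finset.mem_univ, true_and]
    rcases this with ⟨h1, a, h2⟩ | ⟨h1, a, h2⟩ | ⟨h1, h2, h3⟩
    · simp only at h1 h2
      exact ⟨some a, by simp [g, h1, h2]⟩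
    · simp only at h1 h2
      exact ⟨none, by simp [g, h1, h2]⟩
    · simp only at h1 h2 h3
      refine ⟨none, ?_⟩
      have : (!b) = b' := by cases b <;> cases b' <;> simp_all
      simp [g, h2, h3, this]
  have h2 := Finset.card_le_card h1
  rw [Finset.card_image_of_injective _ Subtype.val_injective] at h2
  have h3 := Finset.card_image_le (s := Finset.univ) (f := g)
  rw [Finset.card_univ, Fintype.card_option, Fintype.card_fin] at h3
  omega

/-- The parent in `T_{k,d}`, where the two roots are parents of each other. -/
def parent {k : ℕ} (x : Bool × List (Fin (k - 1))) : Bool × List (Fin (k - 1)) :=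
  match x.2 with
  | [] => (!x.1, [])
  | _ :: w => (x.1, w)

theorem completeTree_adj {x y : CompleteTreeVertex k d} (h : (completeTree k d).Adj x y) :
    IsChild x.1 y.1 ∨ y.1 = parent x.1 := by
  obtain ⟨⟨b, w⟩, hx⟩ := x
  obtain ⟨⟨b', w'⟩, hy⟩ := y
  rcases h with h | ⟨h1, a, h2⟩ | ⟨h1, h2, h3⟩
  · exact Or.inl h
  · simp only at h1 h2
    subst h1 h2
    exact Or.inr rfl
  · simp only at h1 h2 h3
    subst h2 h3
    right
    have : b' = !b := by cases b <;> cases b' <;> simp_all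
    simp [parent, this]

theorem IsChild.parent_eq {x y : Bool × List (Fin (k - 1))} (h : IsChild x y) : parent y = x := by
  obtain ⟨b, w⟩ := x
  obtain ⟨b', w'⟩ := y
  obtain ⟨h1, a, h2⟩ := h
  simp only at h1 h2
  subst h1 h2
  rfl

theorem length_lt_of_isPath_of_parent_notMem {x y : CompleteTreeVertex k d}
    (p : (completeTree k d).Walk x y) (hp : p.IsPath) (h : ∀ z ∈ p.support, z.1 ≠ parent x.1) :
    p.length + x.1.2.length < levels d x.1.1 := by
  induction p with
  | @nil x => simpa using x.2
  | @cons x y z hxy p ih =>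
    rw [Walk.cons_isPath_iff] at hp
    rcases completeTree_adj hxy with hc | hc
    · have := ih hp.1 fun t ht => by
        rw [hc.parent_eq]
        exact fun h => hp.2 (Subtype.ext h ▸ ht)
      obtain ⟨h1, a, h2⟩ := hc
      rw [h1, h2, List.length_cons] at this
      rw [Walk.length_cons]
      omega
    · exact absurd hc (h y (by simp))

/-- A path climbs toward the root and, once it turns down or crosses to the other root, can only
descend. The maximum compares crossing with turning back at the own root. -/
theorem length_le_of_isPath_aux {x y : CompleteTreeVertex k d}
    (p : (completeTree k d).Walk x y) (hp : p.IsPath) :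
    p.length ≤ x.1.2.length + max (levels d (!x.1.1)) (levels d x.1.1 - 1) := by
  induction p with
  | nil => simp
  | @cons x y z hxy p ih =>
    rw [Walk.cons_isPath_iff] at hp
    rw [Walk.length_cons]
    have hback : parent y.1 = x.1 → p.length + y.1.2.length < levels d y.1.1 := fun h =>
      length_lt_of_isPath_of_parent_notMem p hp.1 fun t ht => by
        rw [h]
        exact fun h => hp.2 (Subtype.ext h ▸ ht)
    rcases completeTree_adj hxy with hc | hc
    · have := hback hc.parent_eq
      obtain ⟨h1, a, h2⟩ := hc
      rw [h1, h2, List.length_cons] at this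
      have := le_max_right (levels d (!x.1.1)) (levels d x.1.1 - 1)
      omega
    · obtain ⟨⟨b, w⟩, hx⟩ := x
      cases w with
      | nil =>
        have := hback (by rw [hc]; simp [parent])
        rw [hc] at this
        simp only [parent, List.length_nil] at this ⊢
        have := le_max_left (levels d (!b)) (levels d b - 1)
        omega
      | cons a w =>
        have := ih hp.1
        rw [hc] at this
        simp only [parent, List.length_cons] at this ⊢
        omega

theorem completeTree_length_le {x y : CompleteTreeVertex k d}
    (p : (completeTree k d).Walk x y) (hp : p.IsPath) : p.length ≤ d := by
  have h1 := length_le_of_isPath_aux p hp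
  have h2 := x.2
  generalize x.1.1 = b at h1 h2
  cases b <;> simp only [levels, Bool.not_true, Bool.not_false] at h1 h2 <;> omega

/-- The number of words of length less than `n` over an alphabet with `q` letters. -/
def wordCount (q n : ℕ) : ℕ := ∑ i ∈ Finset.range n, q ^ i

theorem wordCount_mono {q m n : ℕ} (h : m ≤ n) : wordCount q m ≤ wordCount q n :=
  Finset.sum_le_sum_of_subset (Finset.range_mono h)

theorem card_le_wordCount {q n : ℕ} (S : Finset (List (Fin q))) (hS : ∀ w ∈ S, w.length < n) :
    S.card ≤ wordCount q n := by
  let f : (Σ i : Fin n, List.Vector (Fin q) i) → List (Fin q) := fun x => x.2.1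
  have h1 : S ⊆ Finset.univ.image f := fun w hw =>
    Finset.mem_image.2 ⟨⟨⟨w.length, hS w hw⟩, ⟨w, rfl⟩⟩, Finset.mem_univ _, rfl⟩
  refine (Finset.card_le_card h1).trans (Finset.card_image_le.trans ?_)
  simp [wordCount, Finset.sum_range]

/-- Bound for the part of `T_{k,d}` hanging from the child `a` of the vertex `(b, w)`. -/
theorem card_branch_le {b : Bool} {w : List (Fin (k - 1))} {a : Fin (k - 1)}
    (S : Finset (CompleteTreeVertex k d)) (hS : ∀ y ∈ S, y.1.1 = b ∧ (a :: w) <:+ y.1.2) :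
    S.card ≤ wordCount (k - 1) (levels d b - (w.length + 1)) := by
  let f : CompleteTreeVertex k d → List (Fin (k - 1)) := fun y =>
    y.1.2.take (y.1.2.length - (w.length + 1))
  have hf : ∀ y ∈ S, y.1.2 = f y ++ (a :: w) := by
    intro y hy
    obtain ⟨u, hu⟩ := (hS y hy).2
    simp [f, ← hu]
  rw [← Finset.card_image_of_injOn (f := f)]
  · refine card_le_wordCount _ fun u hu => ?_
    obtain ⟨y, hy, rfl⟩ := Finset.mem_image.1 hu
    have h1 := congrArg List.length (hf y hy)
    have h2 := y.2
    rw [(hS y hy).1] at h2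
    rw [List.length_append, List.length_cons] at h1
    omega
  · intro y hy z hz hyz
    refine Subtype.ext (Prod.ext ((hS y hy).1.trans (hS z hz).1.symm) ?_)
    rw [hf y hy, hf z hz, hyz]

/-- The branch below a child can be left only through the parent `(b, w)`. -/
theorem suffix_of_adj {x y : CompleteTreeVertex k d} {b : Bool} {w : List (Fin (k - 1))}
    {a : Fin (k - 1)} (hx : x.1.1 = b ∧ (a :: w) <:+ x.1.2)
    (hxy : (completeTree k d).Adj x y) (hy : y.1 ≠ (b, w)) :
    y.1.1 = b ∧ (a :: w) <:+ y.1.2 := by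
  rcases completeTree_adj hxy with ⟨h1, c, h2⟩ | h
  · rw [h1, h2]
    exact ⟨hx.1, hx.2.trans (List.suffix_cons _ _)⟩
  · obtain ⟨⟨b', w'⟩, hxl⟩ := x
    simp only at hx h
    obtain ⟨rfl, hs⟩ := hx
    cases w' with
    | nil => simp at hs
    | cons c u =>
      simp only [parent] at h
      rw [List.suffix_cons_iff] at hs
      rcases hs with hs | hs
      · rw [List.cons.injEq] at hs
        exact absurd (hs.2 ▸ h) hy
      · rw [h]
        exact ⟨rfl, hs⟩

theorem card_upper_le {h : ℕ} (S : Finset (CompleteTreeVertex k d))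
    (hS : ∀ y ∈ S, y.1.2.length + h + 1 < levels d y.1.1) :
    S.card ≤ wordCount (k - 1) (levels d true - (h + 1)) +
      wordCount (k - 1) (levels d false - (h + 1)) := by
  have key : ∀ b, (S.filter fun y => y.1.1 = b).card ≤
      wordCount (k - 1) (levels d b - (h + 1)) := by
    intro b
    rw [← Finset.card_image_of_injOn (f := fun y : CompleteTreeVertex k d => y.1.2)]
    · refine card_le_wordCount _ fun u hu => ?_
      obtain ⟨y, hy, rfl⟩ := Finset.mem_image.1 hu
      obtain ⟨hyS, rfl⟩ := Finset.mem_filter.1 hy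
      have := hS y hyS
      omega
    · intro y hy z hz hyz
      have h1 := (Finset.mem_filter.1 hy).2
      have h2 := (Finset.mem_filter.1 hz).2
      exact Subtype.ext (Prod.ext (h1.trans h2.symm) hyz)
  have hsplit := Finset.card_filter_add_card_filter_not (s := S)
    (fun y : CompleteTreeVertex k d => y.1.1 = true)
  simp only [Bool.not_eq_true] at hsplit
  have := key true
  have := key false
  omega

end Tree

/-! ### Transfer to the presented graph; counting hubs -/

section Placement

variable {k d n : ℕ} {G : SimpleGraph ℕ} {ψ : ℕ → CompleteTreeVertex k d}

/-- `ψ` places the graph `G` on `0, …, n - 1` in `T_{k,d}`. -/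
structure IsPlacement (G : SimpleGraph ℕ) (n : ℕ) (ψ : ℕ → CompleteTreeVertex k d) : Prop where
  adj_lt : ∀ {a b}, G.Adj a b → a < n
  map_adj : ∀ {a b}, G.Adj a b → (completeTree k d).Adj (ψ a) (ψ b)
  injOn : Set.InjOn ψ (Set.Iio n)

namespace IsPlacement

theorem degree_le (h : IsPlacement G n ψ) (hk : 1 ≤ k) (v : ℕ) (S : Finset ℕ)
    (hS : ∀ u ∈ S, G.Adj v u) : S.card ≤ k := by
  rw [← Finset.card_image_of_injOn (f := ψ) (h.injOn.mono fun u hu => h.adj_lt (hS u hu).symm)]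
  refine completeTree_degree_le hk (ψ v) _ fun y hy => ?_
  obtain ⟨u, hu, rfl⟩ := Finset.mem_image.1 hy
  exact h.map_adj (hS u hu)

theorem length_le (h : IsPlacement G n ψ) {u v : ℕ} (p : G.Walk u v) (hp : p.IsPath) :
    p.length ≤ d := by
  by_cases hu : u < n
  · have hsupp : ∀ {a b : ℕ} (q : G.Walk a b), a < n → ∀ x ∈ q.support, x < n := by
      intro a b q
      induction q with
      | nil => simp
      | cons hab q ih =>
        intro ha x hx
        rw [Walk.support_cons, List.mem_cons] at hx
        rcases hx with rfl | hx
        · exact ha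
        · exact ih (h.adj_lt hab.symm) x hx
    let f : G →g completeTree k d := ⟨ψ, h.map_adj⟩
    rw [← Walk.length_map f p]
    refine completeTree_length_le _ ?_
    rw [Walk.isPath_def, Walk.support_map]
    exact hp.support_nodup.map_on fun x hx y hy hxy =>
      h.injOn (hsupp p hu x hx) (hsupp p hu y hy) hxy
  · cases p with
    | nil => simp
    | cons hab _ => exact absurd (h.adj_lt hab) hu

/-- A component before round `v` avoids `v`, so one containing a child of `v` is trapped in the
branch below that child. Having more than `wordCount (k - 1) m` vertices, it needs more than `m`
levels there. -/
theorem hub_length (h : IsPlacement G n ψ) {m v : ℕ}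
    (hv : IsHub (wordCount (k - 1) m) G v) :
    (ψ v).1.2.length + m + 1 < levels d (ψ v).1.1 := by
  obtain ⟨-, a, b, hab, ha, hb, hca, hcb⟩ := hv
  have hvn : v < n := h.adj_lt ha.1
  have key : ∀ a, (before G (v + 1)).Adj v a → wordCount (k - 1) m < (cluster G v a).ncard →
      IsChild (ψ v).1 (ψ a).1 → (ψ v).1.2.length + m + 1 < levels d (ψ v).1.1 := by
    intro a ha hca hc
    obtain ⟨h1, c, h2⟩ := hc
    have hav := (adj_before_succ ha).2
    have hcl : ∀ u ∈ cluster G v a, u < v ∧ (ψ u).1.1 = (ψ v).1.1 ∧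
        (c :: (ψ v).1.2) <:+ (ψ u).1.2 := by
      intro u hu
      refine ⟨reachable_lt hu hav, ?_⟩
      obtain ⟨p⟩ := Reachable.symm hu
      induction p with
      | nil => exact ⟨h1, h2 ▸ List.suffix_rfl⟩
      | @cons x y z hxy p ih =>
        refine suffix_of_adj (ih ha hca h1 h2 hav ⟨p.reverse⟩) (h.map_adj hxy.1.symm) fun he => ?_
        have := h.injOn (hxy.2.1.trans hvn) hvn (Subtype.ext he)
        have := hxy.2.1
        omega
    by_contra hcon
    have hS := card_branch_le (d := d) (b := (ψ v).1.1) (w := (ψ v).1.2) (a := c)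
      ((cluster_finite (G := G) (n := v) (a := a)).toFinset.image ψ) fun y hy => by
        obtain ⟨u, hu, rfl⟩ := Finset.mem_image.1 hy
        exact (hcl u ((Set.Finite.mem_toFinset _).1 hu)).2
    rw [Finset.card_image_of_injOn fun x hx y hy hxy => h.injOn
      ((hcl x ((Set.Finite.mem_toFinset _).1 hx)).1.trans hvn)
      ((hcl y ((Set.Finite.mem_toFinset _).1 hy)).1.trans hvn) hxy,
      ← Set.ncard_eq_toFinset_card _ (cluster_finite (G := G) (n := v) (a := a))] at hS
    have := hS.trans (wordCount_mono (n := m) (by omega))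
    omega
  -- At most one of the two neighbors is placed at the parent of `v`; the other is a child.
  rcases completeTree_adj (h.map_adj ha.1) with h1 | h1
  · exact key a ha hca h1
  rcases completeTree_adj (h.map_adj hb.1) with h2 | h2
  · exact key b hb hcb h2
  · exact absurd (h.injOn (h.adj_lt ha.1.symm) (h.adj_lt hb.1.symm)
      (Subtype.ext (h1.trans h2.symm))) hab

theorem card_hubs_le (h : IsPlacement G n ψ) {m : ℕ} (S : Finset ℕ)
    (hS : ∀ v ∈ S, IsHub (wordCount (k - 1) m) G v) :
    S.card ≤ wordCount (k - 1) (levels d true - (m + 1)) +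
      wordCount (k - 1) (levels d false - (m + 1)) := by
  rw [← Finset.card_image_of_injOn (f := ψ) (h.injOn.mono fun v hv => by
    obtain ⟨-, a, _, _, ha, _⟩ := hS v hv
    exact h.adj_lt ha.1)]
  refine card_upper_le _ fun y hy => ?_
  obtain ⟨v, hv, rfl⟩ := Finset.mem_image.1 hy
  exact h.hub_length (hS v hv)

end IsPlacement
end Placement

/-! ### Arithmetic of the label budget -/

theorem wordCount_mul {q : ℕ} (hq : 1 ≤ q) (n : ℕ) : (q - 1) * wordCount q n + 1 = q ^ n := by
  obtain ⟨j, rfl⟩ := Nat.exists_eq_add_of_le hq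
  induction n with
  | zero => simp [wordCount]
  | succ n ih =>
    simp only [wordCount, Finset.sum_range_succ, pow_succ, Nat.add_sub_cancel_left] at ih ⊢
    nlinarith

theorem wordCount_lt {q : ℕ} (hq : 2 ≤ q) (n : ℕ) : wordCount q n + 1 ≤ q ^ n := by
  have h1 := wordCount_mul (by omega : 1 ≤ q) n
  have h2 : 1 * wordCount q n ≤ (q - 1) * wordCount q n := Nat.mul_le_mul_right _ (by omega)
  omega

theorem wordCount_succ_le {q : ℕ} (hq : 2 ≤ q) (n : ℕ) : wordCount q (n + 1) + 1 ≤ 2 * q ^ n := by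
  have := wordCount_lt hq n
  simp only [wordCount, Finset.sum_range_succ] at this ⊢
  omega

theorem three_mul_add_two_le (m : ℕ) (hm : 1 ≤ m) : 3 * m + 2 ≤ 3 * 2 ^ m := by
  induction m, hm using Nat.le_induction with
  | base => norm_num
  | succ m _ ih => rw [pow_succ]; omega

/-- With `m = d / 6`, the hubs take at most `3 * q ^ (2 * m)` or `4 * q ^ (2 * m + 1)` labels,
according to `d % 6`. The extenders need about `3 * m * q ^ m`, whose factor `m` is absorbed by
another `q ^ m`. Only `m = 0` needs the 2 in the maximum, and it is treated apart. -/
theorem label_budget {k : ℕ} (hk : 3 ≤ k) (d : ℕ) :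
    wordCount (k - 1) (d / 6) + 1 + max 2 ((k - 1) ^ (d / 6)) * d / 2 +
      (wordCount (k - 1) (levels d true - (d / 6 + 1)) +
        wordCount (k - 1) (levels d false - (d / 6 + 1))) ≤ 6 * (k - 1) ^ (d / 3) := by
  obtain ⟨q, rfl⟩ : ∃ q, k = q + 1 := ⟨k - 1, by omega⟩
  simp only [Nat.add_sub_cancel]
  have hq : 2 ≤ q := by omega
  set m := d / 6 with hm
  have hs := wordCount_lt hq m
  have hpow : q ^ (2 * m) = q ^ m * q ^ m := by rw [two_mul, pow_add]
  have h2q : 2 ^ m ≤ q ^ m := Nat.pow_le_pow_left hq m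
  have hX1 : 1 ≤ q ^ m := Nat.one_le_pow _ _ (by omega)
  by_cases hr : d % 6 < 3
  · have hd : d ≤ 6 * m + 2 := by omega
    have h3 : d / 3 = 2 * m := by omega
    have hc1 : wordCount q (levels d true - (m + 1)) + 1 ≤ 2 * q ^ (2 * m) :=
      (Nat.succ_le_succ (wordCount_mono (by simp only [levels]; omega))).trans
        (wordCount_succ_le hq _)
    have hc2 : wordCount q (levels d false - (m + 1)) + 1 ≤ q ^ (2 * m) :=
      (Nat.succ_le_succ (wordCount_mono (by simp only [levels]; omega))).trans
        (wordCount_lt hq _)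
    rw [h3]
    rcases Nat.eq_zero_or_pos m with h0 | h0
    · rw [h0] at hs hc1 hc2 hd ⊢
      simp at hs hc1 hc2 ⊢
      omega
    · have hmax : max 2 (q ^ m) = q ^ m := max_eq_right (by
        calc 2 ≤ q := hq
          _ ≤ q ^ m := Nat.le_self_pow (by omega) q)
      rw [hmax]
      have h4 : q ^ m * d / 2 ≤ q ^ m * (3 * m + 1) := by
        refine Nat.div_le_of_le_mul ?_
        nlinarith [Nat.mul_le_mul_left (q ^ m) hd]
      have h5 : q ^ m * (3 * m + 2) ≤ 3 * (q ^ m * q ^ m) := by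
        have := Nat.mul_le_mul_left (q ^ m)
          ((three_mul_add_two_le m h0).trans (Nat.mul_le_mul_left 3 h2q))
        linarith
      rw [hpow] at hc1 hc2 ⊢
      have h6 : q ^ m * (3 * m + 2) = q ^ m * (3 * m + 1) + q ^ m := by ring
      omega
  · have hd : d ≤ 6 * m + 5 := by omega
    have h3 : d / 3 = 2 * m + 1 := by omega
    have hc1 : wordCount q (levels d true - (m + 1)) + 1 ≤ 2 * q ^ (2 * m + 1) :=
      (Nat.succ_le_succ (wordCount_mono (by simp only [levels]; omega))).trans
        (wordCount_succ_le hq _)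
    have hc2 : wordCount q (levels d false - (m + 1)) + 1 ≤ 2 * q ^ (2 * m + 1) :=
      (Nat.succ_le_succ (wordCount_mono (by simp only [levels]; omega))).trans
        (wordCount_succ_le hq _)
    rw [h3]
    rcases Nat.eq_zero_or_pos m with h0 | h0
    · rw [h0] at hs hc1 hc2 hd ⊢
      simp at hs hc1 hc2 ⊢
      omega
    · have hmax : max 2 (q ^ m) = q ^ m := max_eq_right (by
        calc 2 ≤ q := hq
          _ ≤ q ^ m := Nat.le_self_pow (by omega) q)
      rw [hmax]
      have h4 : q ^ m * d / 2 ≤ q ^ m * (3 * m + 3) := by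
        refine Nat.div_le_of_le_mul ?_
        nlinarith [Nat.mul_le_mul_left (q ^ m) hd]
      have h5 : q ^ m * (3 * m + 4) ≤ 4 * (q ^ m * q ^ m) := by
        have h7 : 3 * m + 4 ≤ 4 * 2 ^ m := by
          have := three_mul_add_two_le m h0
          have : 2 ≤ 2 ^ m := Nat.le_self_pow (by omega) 2
          omega
        have := Nat.mul_le_mul_left (q ^ m) (h7.trans (Nat.mul_le_mul_left 4 h2q))
        linarith
      have h8 : q ^ (2 * m + 1) = q ^ m * q ^ m * q := by rw [pow_succ, hpow]
      have h9 : q ^ m * q ^ m * 2 ≤ q ^ m * q ^ m * q := Nat.mul_le_mul_left _ hq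
      rw [h8] at hc1 hc2 ⊢
      have h6 : q ^ m * (3 * m + 4) = q ^ m * (3 * m + 3) + q ^ m := by ring
      omega

/-! ### The upper bound -/

theorem level_le_of_isPlacement {k d n : ℕ} (hk : 3 ≤ k) {G : SimpleGraph ℕ}
    {ψ : ℕ → CompleteTreeVertex k d} (h : IsPlacement G n ψ) (m : ℕ) {v : ℕ}
    (hv : IsExtender (wordCount (k - 1) m) G v) :
    level (wordCount (k - 1) m) G v ≤ max 2 ((k - 1) ^ m) * d / 2 := by
  have hN : (k - 2) * wordCount (k - 1) m + 1 ≤ max 2 ((k - 1) ^ m) := by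
    -- The geometric sum turns the bound on seen extenders into exactly `(k - 1) ^ m`.
    rw [← wordCount_mul (by omega : 1 ≤ k - 1) m]
    exact le_max_right _ _
  obtain ⟨r, p, hp, -, -, hlen⟩ := exists_path_of_level (by omega) (le_max_left _ _) hN
    (h.degree_le (by omega)) hv
  rw [Nat.le_div_iff_mul_le two_pos, mul_comm]
  exact hlen.trans (Nat.mul_le_mul_left _ (h.length_le p hp))

theorem exists_placement {k d n : ℕ} {H : SimpleGraph (Fin n)}
    (hH : Presentable (inducedSubgraphs (completeTree k d)) H) :
    ∃ ψ : ℕ → CompleteTreeVertex k d, IsPlacement (H.map Fin.valEmbedding) n ψ := by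
  obtain ⟨m, H', ⟨φ'⟩, ⟨φ⟩⟩ := hH
  let f := φ.trans φ'
  -- The root is a dummy value: injectivity is required only below `n`, and other vertices have no
  -- edges.
  refine ⟨fun i => if h : i < n then f ⟨i, h⟩ else ⟨(true, []), by simp [levels]⟩, ?_, ?_, ?_⟩
  · rintro _ _ ⟨-, a, b, hab, rfl, rfl⟩
    exact a.2
  · rintro _ _ ⟨-, a, b, hab, rfl, rfl⟩
    simpa using f.map_rel_iff.2 hab
  · intro a ha b hb hab
    simp only [Set.mem_Iio] at ha hb
    simp only [ha, hb, dif_pos] at hab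
    exact congrArg Fin.val (f.injective hab)

/-- Ranker's algorithm: small vertices are labeled by the orders of their components, hubs receive
new labels above `M`, and extenders receive labels that decrease from `M`. -/
noncomputable def strategy (s M : ℕ) : Algorithm :=
  fun n H => strategyLabel s M (H.map Fin.valEmbedding) n

theorem strategy_labels {s M n : ℕ} (H : SimpleGraph (Fin n)) (i : Fin n) :
    (strategy s M).labels H i = strategyLabel s M (H.map Fin.valEmbedding) i := by
  refine strategyLabel_congr ?_
  ext a b
  constructor
  · rintro ⟨⟨-, x, y, hxy, rfl, rfl⟩, h1, h2⟩
    exact ⟨⟨fun h => hxy.ne (Fin.ext h), _, _, hxy, rfl, rfl⟩, h1, h2⟩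
  · rintro ⟨⟨-, x, y, hxy, rfl, rfl⟩, h1, h2⟩
    exact ⟨⟨fun h => hxy.ne (Fin.ext h), ⟨x, h1⟩, ⟨y, h2⟩, hxy, rfl, rfl⟩, h1, h2⟩

theorem onlineRankingNumber_completeTree_le {k : ℕ} (hk : 3 ≤ k) (d : ℕ) :
    onlineRankingNumber (completeTree k d) ≤ ((6 * (k - 1) ^ (d / 3) : ℕ) : ℕ∞) := by
  set s := wordCount (k - 1) (d / 6) with hs
  set M := s + 1 + max 2 ((k - 1) ^ (d / 6)) * d / 2 with hM
  have hsM : s < M := by omega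
  refine sInf_le ⟨strategy s M, fun n H hH => ?_, fun n H hH i => ?_⟩
  · obtain ⟨ψ, hψ⟩ := exists_placement hH
    have hR := strategyLabel_isRanking (G := H.map Fin.valEmbedding) hsM fun v hv => by
      have : level s (H.map Fin.valEmbedding) v ≤ _ := level_le_of_isPlacement hk hψ (d / 6) hv
      omega
    refine ⟨fun v => by rw [strategy_labels]; exact hR.1 _, fun u v huv hf p hp => ?_⟩
    rw [strategy_labels, strategy_labels] at hf
    let g := (SimpleGraph.Embedding.map Fin.valEmbedding H).toHom
    have hg : Function.Injective g := (SimpleGraph.Embedding.map Fin.valEmbedding H).injective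
    obtain ⟨w, hw, h⟩ := hR.2 u v (fun h => huv (Fin.ext h)) hf (p.map g)
      (hp.map hg)
    replace hw : w ∈ (p.map g).support := hw
    rw [Walk.support_map, List.mem_map] at hw
    obtain ⟨x, hx, rfl⟩ := hw
    refine ⟨x, hx, ?_⟩
    rw [strategy_labels, strategy_labels]
    exact h
  · obtain ⟨ψ, hψ⟩ := exists_placement hH
    rw [strategy_labels, Nat.cast_le]
    exact (strategyLabel_le hsM (fun S hS => hψ.card_hubs_le S hS) i).trans (label_budget hk d)

/-! ### The lower bound -/

theorem IsRanking.comap {V W : Type*} {G : SimpleGraph V} {G' : SimpleGraph W} {f : V → ℕ}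
    (h : IsRanking G f) (φ : G' ↪g G) : IsRanking G' (f ∘ φ) := by
  refine ⟨fun v => h.1 _, fun u v huv hf p hp => ?_⟩
  obtain ⟨w, hw, hlt⟩ := h.2 (φ u) (φ v) (φ.injective.ne huv) hf (p.map φ.toHom)
    (hp.map φ.injective)
  replace hw : w ∈ (p.map φ.toHom).support := hw
  rw [Walk.support_map, List.mem_map] at hw
  obtain ⟨x, hx, rfl⟩ := hw
  exact ⟨x, hx, hlt⟩

/-- In a connected set the largest label occurs only once. -/
theorem IsRanking.eq_of_forall_le {V : Type*} {G : SimpleGraph V} {f : V → ℕ} (h : IsRanking G f)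
    {S : Set V} (hS : (G.induce S).Preconnected) {u v : V} (hu : u ∈ S) (hv : v ∈ S)
    (huv : f u = f v) (hmax : ∀ x ∈ S, f x ≤ f u) : u = v := by
  by_contra hne
  have h' := h.comap (SimpleGraph.Embedding.comap (Function.Embedding.subtype (· ∈ S)) G)
  obtain ⟨p, hp⟩ := (hS ⟨u, hu⟩ ⟨v, hv⟩).exists_isPath
  obtain ⟨w, -, hw⟩ := h'.2 ⟨u, hu⟩ ⟨v, hv⟩ (fun h => hne (congrArg Subtype.val h)) huv p hp
  exact absurd (hmax w w.2) (not_le.2 hw)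

section LowerBound

variable {k e : ℕ}

/-- The vertices of the `(k - 1)`-ary rooted tree with `e` levels. -/
abbrev ShortWord (k e : ℕ) : Type := {w : List (Fin (k - 1)) // w.length < e}

instance : Finite (ShortWord k e) := (List.finite_length_lt (Fin (k - 1)) e).to_subtype

noncomputable instance : Fintype (ShortWord k e) := Fintype.ofFinite _

/-- The words that Presenter assigns to the vertices presented: copy `j` of the tree with `e` levels
is put at the top, and the other copies are put below the words of length `e`. -/
def place (a₀ : Fin (k - 1)) (j : Option (List.Vector (Fin (k - 1)) e)) :
    (Option (List.Vector (Fin (k - 1)) e) × ShortWord k e) ⊕ List.Vector (Fin (k - 1)) e →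
      List (Fin (k - 1))
  | Sum.inl (i, w) => (Equiv.swap j none i).elim w.1 fun y => w.1 ++ a₀ :: y.1
  | Sum.inr y => y.1

variable {a₀ : Fin (k - 1)} {j : Option (List.Vector (Fin (k - 1)) e)}

theorem place_top (w : ShortWord k e) : place a₀ j (Sum.inl (j, w)) = w.1 := by
  simp [place]

theorem place_below (y : List.Vector (Fin (k - 1)) e) (w : ShortWord k e) :
    place a₀ j (Sum.inl (Equiv.swap j none (some y), w)) = w.1 ++ a₀ :: y.1 := by
  simp [place]

/-- The swap sends the chosen copy `j` to `none`, the top position, and matches all other copies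
bijectively with the words of length `e`. -/
theorem exists_copy_eq (j i : Option (List.Vector (Fin (k - 1)) e)) :
    i = j ∨ ∃ y, i = Equiv.swap j none (some y) := by
  rcases h : Equiv.swap j none i with _ | y
  · left
    have := congrArg (Equiv.swap j none) h
    simpa using this
  · right
    exact ⟨y, by rw [← h, Equiv.swap_apply_self]⟩

theorem swap_some_ne (y : List.Vector (Fin (k - 1)) e) : Equiv.swap j none (some y) ≠ j := by
  intro h
  have := congrArg (Equiv.swap j none) h
  simp at this

theorem place_length (x) : (place a₀ j x).length ≤ 2 * e := by
  rcases x with ⟨i, w⟩ | y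
  · have := w.2
    rcases exists_copy_eq j i with rfl | ⟨y, rfl⟩
    · rw [place_top]
      omega
    · have hy := y.2
      rw [place_below, List.length_append, List.length_cons, hy]
      omega
  · have := y.2
    change y.1.length ≤ _
    omega

theorem append_cons_inj {y y' : List.Vector (Fin (k - 1)) e} {w w' : List (Fin (k - 1))}
    (h : w ++ a₀ :: y.1 = w' ++ a₀ :: y'.1) : w = w' ∧ y = y' := by
  have h1 := List.append_inj' h (by simp [y.2, y'.2])
  exact ⟨h1.1, Subtype.ext (List.cons.inj h1.2).2⟩

theorem place_injective : Function.Injective (place a₀ j) := by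
  have key : ∀ i (w : ShortWord k e) (y' : List.Vector (Fin (k - 1)) e),
      place a₀ j (Sum.inl (i, w)) ≠ y'.1 := by
    intro i w y' h
    have h1 := congrArg List.length h
    have := w.2
    have := y'.2
    rcases exists_copy_eq j i with rfl | ⟨y, rfl⟩
    · rw [place_top] at h1
      omega
    · have := y.2
      rw [place_below, List.length_append, List.length_cons] at h1
      omega
  rintro (⟨i, w⟩ | y) (⟨i', w'⟩ | y') h
  · have h1 := congrArg List.length h
    have hw := w.2
    have hw' := w'.2
    have hi := exists_copy_eq j i
    have hi' := exists_copy_eq j i'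
    rcases hi with rfl | ⟨y, rfl⟩ <;> rcases hi' with rfl | ⟨y', rfl⟩
    · rw [place_top, place_top] at h
      rw [Subtype.ext h]
    · have := y'.2
      rw [place_top, place_below, List.length_append, List.length_cons] at h1
      omega
    · have := y.2
      rw [place_top, place_below, List.length_append, List.length_cons] at h1
      omega
    · rw [place_below, place_below] at h
      obtain ⟨h2, rfl⟩ := append_cons_inj h
      rw [Subtype.ext h2]
  · exact absurd h (key i w y')
  · exact absurd h.symm (key i' w' y)
  · exact congrArg Sum.inr (Subtype.ext h)

/-- The right side does not mention `j`: distinct copies are kept apart by the level of words of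
length `e`, so before the connecting vertices arrive all choices of `j` give the same graph. -/
theorem place_child_iff (i i' : Option (List.Vector (Fin (k - 1)) e)) (w w' : ShortWord k e) :
    (∃ a, place a₀ j (Sum.inl (i', w')) = a :: place a₀ j (Sum.inl (i, w))) ↔
      i' = i ∧ ∃ a, w'.1 = a :: w.1 := by
  have hw := w.2
  have hw' := w'.2
  have hi := exists_copy_eq j i
  have hi' := exists_copy_eq j i'
  rcases hi with rfl | ⟨y, rfl⟩ <;> rcases hi' with rfl | ⟨y', rfl⟩
  · simp [place_top]
  · rw [place_top, place_below]
    refine iff_of_false ?_ fun h => swap_some_ne y' h.1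
    rintro ⟨a, h⟩
    have h1 := congrArg List.length h
    have := y'.2
    simp only [List.length_append, List.length_cons] at h1
    omega
  · rw [place_top, place_below]
    refine iff_of_false ?_ fun h => swap_some_ne y h.1.symm
    rintro ⟨a, h⟩
    have h1 := congrArg List.length h
    have := y.2
    simp only [List.length_append, List.length_cons] at h1
    omega
  · rw [place_below, place_below]
    constructor
    · rintro ⟨a, h⟩
      rw [← List.cons_append] at h
      obtain ⟨h1, rfl⟩ := append_cons_inj h
      exact ⟨rfl, a, h1⟩
    · rintro ⟨h, a, h1⟩
      have := (Equiv.swap j none).injective h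
      rw [Option.some.injEq] at this
      exact ⟨a, by rw [h1, this, List.cons_append]⟩

/-- The vertices of the top copy and of the branches below the words in `B`. -/
def region (j : Option (List.Vector (Fin (k - 1)) e)) (B : Set (List.Vector (Fin (k - 1)) e)) :
    Set ((Option (List.Vector (Fin (k - 1)) e) × ShortWord k e) ⊕ List.Vector (Fin (k - 1)) e) :=
  {x | (∃ w, x = Sum.inl (j, w)) ∨
    ∃ y ∈ B, x = Sum.inr y ∨ ∃ w, x = Sum.inl (Equiv.swap j none (some y), w)}

theorem region_tail {B : Set (List.Vector (Fin (k - 1)) e)} {x} (hx : x ∈ region j B)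
    {a : Fin (k - 1)} {u : List (Fin (k - 1))} (h : place a₀ j x = a :: u) :
    ∃ x' ∈ region j B, place a₀ j x' = u := by
  rcases hx with ⟨w, rfl⟩ | ⟨y, hy, rfl | ⟨w, rfl⟩⟩
  · rw [place_top] at h
    have := w.2
    rw [h, List.length_cons] at this
    exact ⟨Sum.inl (j, ⟨u, by omega⟩), Or.inl ⟨_, rfl⟩, place_top _⟩
  · have := y.2
    replace h : y.1 = a :: u := h
    rw [h, List.length_cons] at this
    exact ⟨Sum.inl (j, ⟨u, by omega⟩), Or.inl ⟨_, rfl⟩, place_top _⟩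
  · rw [place_below] at h
    obtain ⟨w, hw⟩ := w
    cases w with
    | nil => exact ⟨Sum.inr y, Or.inr ⟨y, hy, Or.inl rfl⟩, (List.cons.inj h).2⟩
    | cons c w =>
      refine ⟨Sum.inl (Equiv.swap j none (some y), ⟨w, ?_⟩), Or.inr ⟨y, hy, Or.inr ⟨_, rfl⟩⟩, ?_⟩
      · rw [List.length_cons] at hw
        omega
      · rw [place_below]
        exact (List.cons.inj h).2

/-- Deleting letters one at a time leads, inside `S`, to the unique vertex with the empty word. -/
theorem induce_preconnected_of_tail_mem {V : Type*} {G : SimpleGraph V} (word : V → List (Fin (k - 1)))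
    (hinj : Function.Injective word) (hG : ∀ x y a, word x = a :: word y → G.Adj x y) {S : Set V}
    (hS : ∀ x ∈ S, ∀ a u, word x = a :: u → ∃ y ∈ S, word y = u) : (G.induce S).Preconnected := by
  have key : ∀ l, ∀ x : S, word x = l → ∃ r : S, word r = [] ∧ (G.induce S).Reachable x r := by
    intro l
    induction l with
    | nil => exact fun x hx => ⟨x, hx, Reachable.refl _⟩
    | cons a u ih =>
      intro x hx
      obtain ⟨y, hy, hyu⟩ := hS x x.2 a u hx
      obtain ⟨r, hr, hyr⟩ := ih ⟨y, hy⟩ hyu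
      refine ⟨r, hr, Reachable.trans (Adj.reachable ?_) hyr⟩
      exact hG x y a (hyu ▸ hx)
  intro x y
  obtain ⟨r, hr, hxr⟩ := key _ x rfl
  obtain ⟨r', hr', hyr⟩ := key _ y rfl
  have : r = r' := Subtype.ext (hinj (hr.trans hr'.symm))
  exact (this ▸ hxr).trans hyr.symm

/-- The counting core: each `y` is charged to the largest label on its stem and branch. This
dominates the top copy, so `hsep'` makes these labels distinct elements of `{1, …, t}`. -/
theorem card_le_of_copies {α Y Q : Type*} [Fintype Y] [Fintype Q] [Nonempty Q] (f : α → ℕ)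
    (top : Q → α) (stem : Y → α) (branch : Y → Q → α) (t : ℕ) (ht : ∀ x, f x ≤ t)
    (hpos : ∀ x, 1 ≤ f x) (htop : ∀ y, Finset.univ.sup (f ∘ top) ≤ Finset.univ.sup (f ∘ branch y))
    (hsep : ∀ y x x', (∃ w, x = top w) → (x' = stem y ∨ ∃ w, x' = branch y w) → f x = f x' →
      (∀ w, f (top w) ≤ f x) → f (stem y) ≤ f x → (∀ w, f (branch y w) ≤ f x) → False)
    (hsep' : ∀ y y' x x', y ≠ y' → (x = stem y ∨ ∃ w, x = branch y w) →
      (x' = stem y' ∨ ∃ w, x' = branch y' w) → f x = f x' → (∀ w, f (top w) ≤ f x) →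
      f (stem y) ≤ f x → f (stem y') ≤ f x → (∀ w, f (branch y w) ≤ f x) →
      (∀ w, f (branch y' w) ≤ f x) → False) : Fintype.card Y ≤ t := by
  obtain ⟨w₀, -, hw₀⟩ := Finset.exists_mem_eq_sup Finset.univ Finset.univ_nonempty (f ∘ top)
  have hw₀' : ∀ w, f (top w) ≤ f (top w₀) := fun w =>
    (Finset.le_sup (f := f ∘ top) (Finset.mem_univ w)).trans hw₀.le
  have hz : ∀ y, ∃ z, (z = stem y ∨ ∃ w, z = branch y w) ∧ f (stem y) ≤ f z ∧
      (∀ w, f (branch y w) ≤ f z) ∧ f (top w₀) ≤ f z := by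
    intro y
    obtain ⟨w, -, hw⟩ := Finset.exists_mem_eq_sup Finset.univ Finset.univ_nonempty (f ∘ branch y)
    have h1 : ∀ w', f (branch y w') ≤ f (branch y w) := fun w' =>
      (Finset.le_sup (f := f ∘ branch y) (Finset.mem_univ w')).trans hw.le
    have h2 : f (top w₀) ≤ f (branch y w) := by
      have := htop y
      rw [hw₀, hw] at this
      exact this
    rcases le_total (f (stem y)) (f (branch y w)) with h | h
    · exact ⟨branch y w, Or.inr ⟨w, rfl⟩, h, h1, h2⟩
    · exact ⟨stem y, Or.inl rfl, le_rfl, fun w' => (h1 w').trans h, h2.trans h⟩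
  choose z hz1 hz2 hz3 hz4 using hz
  have hne : ∀ y, f (top w₀) ≠ f (z y) := fun y h =>
    hsep y _ _ ⟨w₀, rfl⟩ (hz1 y) h hw₀' (h ▸ hz2 y) fun w => h ▸ hz3 y w
  have hinj : Function.Injective fun y => f (z y) := by
    intro y y' h
    by_contra hyy
    replace h : f (z y) = f (z y') := h
    exact hsep' y y' _ _ hyy (hz1 y) (hz1 y') h (fun w => (hw₀' w).trans (hz4 y)) (hz2 y)
      (h ▸ hz2 y') (hz3 y) fun w => h ▸ hz3 y' w
  have := Finset.card_le_card_of_injOn (s := Finset.univ) (t := Finset.Icc 1 t)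
    (fun y => f (z y)) (fun y _ => by simpa using ⟨hpos (z y), ht (z y)⟩) hinj.injOn
  simpa using this

variable {d : ℕ}

/-- The vertex of `T_{k,d}` named by `place`. -/
def vertexAt (hd : 4 * e ≤ d) (a₀ : Fin (k - 1)) (j : Option (List.Vector (Fin (k - 1)) e))
    (x : (Option (List.Vector (Fin (k - 1)) e) × ShortWord k e) ⊕ List.Vector (Fin (k - 1)) e) :
    CompleteTreeVertex k d :=
  ⟨(true, place a₀ j x), by
    have := place_length (a₀ := a₀) (j := j) x
    simp only [levels]
    omega⟩

theorem vertexAt_injective (hd : 4 * e ≤ d) : Function.Injective (vertexAt hd a₀ j) := by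
  intro x y h
  have := congrArg (fun z => z.1.2) h
  exact place_injective this

theorem vertexAt_adj (hd : 4 * e ≤ d) {x y} :
    (completeTree k d).Adj (vertexAt hd a₀ j x) (vertexAt hd a₀ j y) ↔
      (∃ a, place a₀ j y = a :: place a₀ j x) ∨ ∃ a, place a₀ j x = a :: place a₀ j y := by
  simp [completeTree, IsChild, vertexAt]

theorem one_le_onlineRankingNumber : 1 ≤ onlineRankingNumber (completeTree k d) := by
  refine le_sInf ?_
  rintro t ⟨A, hA, hAt⟩
  let x : CompleteTreeVertex k d := ⟨(true, []), by simp [levels]⟩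
  let f : Fin 1 ↪ CompleteTreeVertex k d := ⟨fun _ => x, fun _ _ _ => Subsingleton.elim _ _⟩
  have hP : Presentable (inducedSubgraphs (completeTree k d)) ((completeTree k d).comap f) :=
    ⟨1, _, ⟨SimpleGraph.Embedding.comap f _⟩, ⟨SimpleGraph.Embedding.refl⟩⟩
  refine le_trans ?_ (hAt 1 _ hP 0)
  exact_mod_cast (hA 1 _ hP).1 0

theorem pow_le_of_isValid (hk : 2 ≤ k) (he : 1 ≤ e) (hd : 4 * e ≤ d) {A : Algorithm}
    (hA : A.IsValid (inducedSubgraphs (completeTree k d))) {t : ℕ}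
    (ht : ∀ (n : ℕ) (H : SimpleGraph (Fin n)), Presentable (inducedSubgraphs (completeTree k d)) H →
      ∀ i, A.labels H i ≤ t) : (k - 1) ^ e ≤ t := by
  let a₀ : Fin (k - 1) := ⟨0, by omega⟩
  let Y := List.Vector (Fin (k - 1)) e
  let X := Option Y × ShortWord k e
  -- All copies are presented first, the connecting vertices last.
  let E : X ⊕ Y ≃ Fin (Fintype.card X + Fintype.card Y) :=
    (Equiv.sumCongr (Fintype.equivFin X) (Fintype.equivFin Y)).trans finSumFinEquiv
  let H : Option Y → SimpleGraph (Fin (Fintype.card X + Fintype.card Y)) := fun j =>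
    (completeTree k d).comap (vertexAt hd a₀ j ∘ E.symm)
  have hP : ∀ j, Presentable (inducedSubgraphs (completeTree k d)) (H j) := fun j =>
    ⟨_, H j, ⟨SimpleGraph.Embedding.comap
      ⟨_, (vertexAt_injective hd).comp E.symm.injective⟩ (completeTree k d)⟩,
      ⟨SimpleGraph.Embedding.refl⟩⟩
  let f : Option Y → X ⊕ Y → ℕ := fun j x => A.labels (H j) (E x)
  let φ : ∀ j, (completeTree k d).comap (vertexAt hd a₀ j) ↪g H j := fun j =>
    ⟨E.toEmbedding, by simp [H]⟩
  have hf : ∀ j, IsRanking ((completeTree k d).comap (vertexAt hd a₀ j)) (f j) := fun j =>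
    (hA _ _ (hP j)).comap (φ j)
  have hE : ∀ i : Fin (Fintype.card X + Fintype.card Y), (i : ℕ) < Fintype.card X →
      ∃ x : X, E.symm i = Sum.inl x := by
    intro i hi
    refine ⟨(Fintype.equivFin X).symm ⟨i, hi⟩, ?_⟩
    rw [Equiv.symm_apply_eq]
    ext
    simp [E]
  have hElt : ∀ x : X, (E (Sum.inl x) : ℕ) < Fintype.card X := by
    intro x
    simp [E]
  -- Ranker labels the copies without knowing `j`, which Presenter may therefore choose afterwards.
  have hindep : ∀ j x, f j (Sum.inl x) = f none (Sum.inl x) := by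
    intro j x
    have : (H j).comap (Fin.castLE (Nat.succ_le_of_lt (E (Sum.inl x)).isLt)) =
        (H none).comap (Fin.castLE (Nat.succ_le_of_lt (E (Sum.inl x)).isLt)) := by
      ext a b
      obtain ⟨⟨i, w⟩, hx⟩ := hE (Fin.castLE (Nat.succ_le_of_lt (E (Sum.inl x)).isLt) a)
        (lt_of_le_of_lt (Nat.le_of_lt_succ a.2) (hElt x))
      obtain ⟨⟨i', w'⟩, hy⟩ := hE (Fin.castLE (Nat.succ_le_of_lt (E (Sum.inl x)).isLt) b)
        (lt_of_le_of_lt (Nat.le_of_lt_succ b.2) (hElt x))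
      simp only [H, SimpleGraph.comap_adj, Function.comp_apply, hx, hy, vertexAt_adj,
        place_child_iff]
    simp only [f, Algorithm.labels, this]
  have : Nonempty (ShortWord k e) := ⟨⟨[], he⟩⟩
  obtain ⟨j, -, hj⟩ := (Finset.univ : Finset (Option Y)).exists_min_image
    (fun i => Finset.univ.sup fun w : ShortWord k e => f none (Sum.inl (i, w)))
    Finset.univ_nonempty
  have hcard : Fintype.card Y = (k - 1) ^ e := by simp [Y]
  have hsub : ∀ (B : Set Y) x x', x ∈ region j B → x' ∈ region j B → f j x = f j x' →
      (∀ z ∈ region j B, f j z ≤ f j x) → x = x' := fun B x x' hx hx' hxx hmax =>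
    (hf j).eq_of_forall_le (induce_preconnected_of_tail_mem (place a₀ j) place_injective
      (fun x y a h => (vertexAt_adj hd).2 (Or.inr ⟨a, h⟩))
      fun x hx a u h => region_tail hx h) hx hx' hxx hmax
  rw [← hcard]
  refine card_le_of_copies (f j) (fun w : ShortWord k e => Sum.inl (j, w)) Sum.inr
    (fun y w => Sum.inl (Equiv.swap j none (some y), w)) t (fun x => ht _ _ (hP j) _) (hf j).1
    (fun y => ?_) ?_ ?_
  · have := hj (Equiv.swap j none (some y)) (Finset.mem_univ _)
    simpa only [Function.comp_def, hindep] using this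
  · rintro y x x' ⟨w, rfl⟩ hx' hxx h1 h2 h3
    have := hsub {y} _ _ (Or.inl ⟨w, rfl⟩) (Or.inr ⟨y, rfl, hx'⟩) hxx (by
      rintro z (⟨w, rfl⟩ | ⟨_, rfl, rfl | ⟨w, rfl⟩⟩)
      · exact h1 w
      · exact h2
      · exact h3 w)
    subst this
    rcases hx' with h | ⟨w', h⟩
    · exact absurd h (by simp)
    · rw [Sum.inl.injEq, Prod.mk.injEq] at h
      exact swap_some_ne y h.1.symm
  · rintro y y' x x' hyy hx hx' hxx h0 h1 h1' h2 h2'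
    have := hsub {y, y'} _ _ (Or.inr ⟨y, Or.inl rfl, hx⟩) (Or.inr ⟨y', Or.inr rfl, hx'⟩) hxx (by
      rintro z (⟨w, rfl⟩ | ⟨_, rfl | rfl, rfl | ⟨w, rfl⟩⟩)
      · exact h0 w
      · exact h1
      · exact h2 w
      · exact h1'
      · exact h2' w)
    subst this
    rcases hx with rfl | ⟨w, rfl⟩ <;> rcases hx' with h | ⟨w', h⟩
    · exact hyy (Sum.inr.inj h)
    · exact absurd h (by simp)
    · exact absurd h (by simp)
    · rw [Sum.inl.injEq, Prod.mk.injEq, EmbeddingLike.apply_eq_iff_eq, Option.some.injEq] at h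
      exact hyy h.1

theorem le_onlineRankingNumber_completeTree (hk : 2 ≤ k) (d : ℕ) :
    (((k - 1) ^ (d / 4) : ℕ) : ℕ∞) ≤ onlineRankingNumber (completeTree k d) := by
  -- The copies are nonempty only for `d / 4 ≥ 1`; otherwise a single vertex gives the bound 1.
  rcases Nat.eq_zero_or_pos (d / 4) with h0 | h0
  · rw [h0]
    exact_mod_cast one_le_onlineRankingNumber
  refine le_sInf ?_
  rintro t ⟨A, hA, hAt⟩
  induction t using ENat.recTopCoe with
  | top => exact le_top
  | coe t =>
    rw [Nat.cast_le]
    exact pow_le_of_isValid hk h0 (by omega) hA fun n H hH i => Nat.cast_le.1 (hAt n H hH i)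

end LowerBound
end OnlineRanking

theorem theorem1 :
    (∃ c c' : ℝ, 0 < c ∧ 0 < c' ∧ ∀ d k : ℕ, 3 ≤ k →
      ∃ r : ℕ, OnlineRanking.onlineRankingNumber (OnlineRanking.completeTree k d) = (r : ℕ∞) ∧
        c * ((k : ℝ) - 1) ^ (d / 4) ≤ (r : ℝ) ∧ (r : ℝ) ≤ c' * ((k : ℝ) - 1) ^ (d / 3)) ∧
    (∀ d k : ℕ, 3 ≤ k →
      (((k - 1) ^ (d / 4) : ℕ) : ℕ∞) ≤
          OnlineRanking.onlineRankingNumber (OnlineRanking.completeTree k d) ∧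
        OnlineRanking.onlineRankingNumber (OnlineRanking.completeTree k d) ≤
          ((6 * (k - 1) ^ (d / 3) : ℕ) : ℕ∞)) := by
  have main : ∀ d k : ℕ, 3 ≤ k →
      (((k - 1) ^ (d / 4) : ℕ) : ℕ∞) ≤
          OnlineRanking.onlineRankingNumber (OnlineRanking.completeTree k d) ∧
        OnlineRanking.onlineRankingNumber (OnlineRanking.completeTree k d) ≤
          ((6 * (k - 1) ^ (d / 3) : ℕ) : ℕ∞) := fun d k hk =>
    ⟨OnlineRanking.le_onlineRankingNumber_completeTree (by omega) d,
      OnlineRanking.onlineRankingNumber_completeTree_le hk d⟩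
  refine ⟨⟨1, 6, one_pos, by norm_num, fun d k hk => ?_⟩, main⟩
  obtain ⟨h1, h2⟩ := main d k hk
  obtain ⟨r, hr⟩ := ENat.ne_top_iff_exists.1 (ne_top_of_le_ne_top (ENat.natCast_ne_top _) h2)
  rw [← hr, Nat.cast_le] at h1 h2
  have hk1 : (k : ℝ) - 1 = ((k - 1 : ℕ) : ℝ) := by
    rw [Nat.cast_sub (by omega), Nat.cast_one]
  refine ⟨r, hr.symm, ?_, ?_⟩
  · rw [hk1, one_mul]
    exact_mod_cast h1
  · rw [hk1]
    exact_mod_cast h2
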